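/- Let $n\ge 5$, $p\ge 1$, $\zeta\in(0,1)$, and put $2^{**}=\frac{2n}{n-4}$, $c(n)=\frac{n(n-4)(n^2-4)}{16}$, $K_0=\frac{n^2(n-4)^2}{16}$, $K_2=\frac{n^2-4n+8}{2}$, $J_0=\frac{n(n-4)}{2}$, $a_0=\bigl[\frac{n(n-4)}{n^2-4}\bigr]^{(n-4)/8}$. For $a\in(0,a_0]$ let $v_a$ be an Emden--Fowler solution with Fowler parameter $a$, i.e. a positive periodic $C^4$ solution on $\mathbb R$ of $v^{(4)}-K_2v''+K_0v=c(n)v^{2^{**}-1}$ with $v(0)=a=\min v$ and $v'(0)=v'''(0)=0$; for $a=0$ let $v_0(t)=(\cosh t)^{-(n-4)/2}$. Let $T\in\mathbb R$, let $\Lambda\in\mathbb S^{p-1}$ have nonnegative components, and put $\mathcal V_{a,T}(t)=v_a(t+T)\Lambda$. On $p$-maps on the cylinder $\mathcal C_0=(0,\infty)\times\mathbb S^{n-1}$ let $$\mathcal L^a\Phi=\partial_t^4\Phi-K_2\partial_t^2\Phi+K_0\Phi+\Delta_\theta^2\Phi+2\partial_t^2\Delta_\theta\Phi-J_0\Delta_\theta\Phi-Df(\mathcal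 V_{a,T})[\Phi],\qquad f(V)=c(n)|V|^{2^{**}-2}V,$$ be the linearization at $\mathcal V_{a,T}$ of $\mathcal V\mapsto\Delta^2_{\rm cyl}\mathcal V-f(\mathcal V)$. For $j\in\mathbb N$ let $\mathcal L^a_j$ be the restriction of $\mathcal L^a$ to maps $\Phi$ such that the components of $\Phi(t,\cdot)$ lie, for every $t$, in the eigenspace of $-\Delta_\theta$ on $\mathbb S^{n-1}$ with eigenvalue $\lambda_j=j(j+n-2)$. A number $\beta\in\mathbb R$ is an indicial root of $\mathcal L^a_j$ if there are such a map $\Phi\in C^{4,\zeta}(\mathcal C_0,\mathbb R^p)$ (derivatives up to order $4$ bounded, those of order $4$ uniformly $\zeta$-Hölder) and some $\beta'<\beta$ with $$\limsup_{t\to\infty}\|\Phi(t,\cdot)\|_{L^\infty(\mathbb S^{n-1})}>0\quad\text{and}\quad \lim_{t\to\infty}e^{-\beta't}\mathcal L^a_j\bigl(e^{\beta t}\Phi\bigr)=0\ \text{ uniformly on }\mathbb S^{n-1}.$$ Let $\mathfrak I^a$ be the set of all indicial roots of all $\mathcal L^a_j$, $j\in\mathbb N$. Then for every $a\in(0,a_0]$,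 $0$ is an isolated indicial root of $\mathcal L^a$: $0\in\mathfrak I^a$, and there is $\varepsilon>0$ with $\mathfrak I^a\cap(-\varepsilon,\varepsilon)=\{0\}$. If moreover $p\ge2$, then $\Phi$ for the root $0$ can be chosen with $\liminf_{t\to\infty}\|\Phi(t,\cdot)\|_{L^\infty(\mathbb S^{n-1})}>0$. For $a=0$, too, there is $\varepsilon>0$ such that $\mathfrak I^0\cap(-\varepsilon,\varepsilon)\subseteq\{0\}$. -/

import Mathlib

open Filter Topology Metric Laplacian

noncomputable section

namespace EmdenFowler

/-! ### Dimensional constants -/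

/-- `K₀ = n²(n-4)²/16`. -/
def K₀ (n : ℕ) : ℝ := (n : ℝ) ^ 2 * ((n : ℝ) - 4) ^ 2 / 16

/-- `K₂ = (n²-4n+8)/2`. -/
def K₂ (n : ℕ) : ℝ := ((n : ℝ) ^ 2 - 4 * (n : ℝ) + 8) / 2

/-- `J₀ = n(n-4)/2`. -/
def J₀ (n : ℕ) : ℝ := (n : ℝ) * ((n : ℝ) - 4) / 2

/-- The normalizing constant `c(n) = n(n-4)(n²-4)/16`. -/
def c (n : ℕ) : ℝ := (n : ℝ) * ((n : ℝ) - 4) * ((n : ℝ) ^ 2 - 4) / 16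

/-- The critical Sobolev exponent `2** = 2n/(n-4)`. -/
def critExp (n : ℕ) : ℝ := 2 * (n : ℝ) / ((n : ℝ) - 4)

/-- The Fowler scaling exponent `γ = (n-4)/2`. -/
def γ (n : ℕ) : ℝ := ((n : ℝ) - 4) / 2

/-- The largest Fowler parameter `a₀ = [n(n-4)/(n²-4)]^((n-4)/8)`. -/
def a₀ (n : ℕ) : ℝ :=
  ((n : ℝ) * ((n : ℝ) - 4) / ((n : ℝ) ^ 2 - 4)) ^ (((n : ℝ) - 4) / 8)

/-! ### Emden–Fowler solutions -/

/-- `v` is a positive periodic solution of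
`v⁗ - K₂ v'' + K₀ v = c(n) v^(2**-1)` on `ℝ`, with
`v(0) = a = min v` and `v'(0) = v'''(0) = 0`. -/
structure IsPeriodicFowler (n : ℕ) (a : ℝ) (v : ℝ → ℝ) : Prop where
  contDiff : ContDiff ℝ 4 v
  ode : ∀ t, iteratedDeriv 4 v t - K₂ n * iteratedDeriv 2 v t + K₀ n * v t
    = c n * v t ^ (critExp n - 1)
  pos : ∀ t, 0 < v t
  periodic : ∃ P : ℝ, 0 < P ∧ Function.Periodic v P
  value_zero : v 0 = a
  min_le : ∀ t, a ≤ v t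
  deriv_one : deriv v 0 = 0
  deriv_three : iteratedDeriv 3 v 0 = 0

/-- `v` is an Emden–Fowler profile `v_a` with Fowler parameter `a`. For `a > 0` it is periodic;
for the limit value `a = 0` it is the spherical solution `(cosh t)^(-γ)`. -/
def IsFowlerProfile (n : ℕ) (a : ℝ) (v : ℝ → ℝ) : Prop :=
  (0 < a ∧ IsPeriodicFowler n a v) ∨ (a = 0 ∧ ∀ t, v t = Real.cosh t ^ (-γ n))

/-- The vectorial solution `𝒱_{a,T}(t) = v_a(t+T) Λ`. -/
def fowlerMap {p : ℕ} (v : ℝ → ℝ) (T : ℝ) (Λ : EuclideanSpace ℝ (Fin p)) :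
    ℝ → EuclideanSpace ℝ (Fin p) :=
  fun t => v (t + T) • Λ

/-! ### The linearized operator on the cylinder

A `p`-map on the cylinder `(0,∞) × 𝕊ⁿ⁻¹` is a function
`Φ : ℝ → EuclideanSpace ℝ (Fin n) → EuclideanSpace ℝ (Fin p)` of which only the values `Φ t θ` with
`t > 0`, `‖θ‖ = 1` matter. -/

/-- Extension of a function on the unit sphere as a function that is constant along rays. -/
def radialExt {n p : ℕ} (χ : EuclideanSpace ℝ (Fin n) → EuclideanSpace ℝ (Fin p)) :
    EuclideanSpace ℝ (Fin n) → EuclideanSpace ℝ (Fin p) :=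
  fun x => χ (‖x‖⁻¹ • x)

/-- The Laplace–Beltrami operator `Δ_θ` of the unit sphere, applied componentwise: at a point of
the sphere it is the Euclidean Laplacian of the extension that is constant along rays. -/
def sphLaplacian {n p : ℕ} (χ : EuclideanSpace ℝ (Fin n) → EuclideanSpace ℝ (Fin p)) :
    EuclideanSpace ℝ (Fin n) → EuclideanSpace ℝ (Fin p) :=
  fun θ => (Δ (radialExt χ)) θ

/-- The bi-Laplacian in logarithmic cylindrical coordinates,
`∂ₜ⁴ - K₂ ∂ₜ² + K₀ + Δ_θ² + 2 ∂ₜ² Δ_θ - J₀ Δ_θ`. -/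
def cylBilaplacian {n p : ℕ}
    (Φ : ℝ → EuclideanSpace ℝ (Fin n) → EuclideanSpace ℝ (Fin p))
    (t : ℝ) (θ : EuclideanSpace ℝ (Fin n)) : EuclideanSpace ℝ (Fin p) :=
  iteratedDeriv 4 (fun s => Φ s θ) t - K₂ n • iteratedDeriv 2 (fun s => Φ s θ) t + K₀ n • Φ t θ
    + sphLaplacian (sphLaplacian (Φ t)) θ
    + (2 : ℝ) • iteratedDeriv 2 (fun s => sphLaplacian (Φ s) θ) t
    - J₀ n • sphLaplacian (Φ t) θ

/-- The Gross–Pitaevskii nonlinearity `V ↦ c(n) |V|^(2**-2) V`. -/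
def nonlinearity (n p : ℕ) (V : EuclideanSpace ℝ (Fin p)) : EuclideanSpace ℝ (Fin p) :=
  (c n * ‖V‖ ^ (critExp n - 2)) • V

/-- The linearization of `V ↦ Δ²_cyl V - c(n) |V|^(2**-2) V` at a map `V = V(t)`. -/
def linearized {n p : ℕ} (V : ℝ → EuclideanSpace ℝ (Fin p))
    (Φ : ℝ → EuclideanSpace ℝ (Fin n) → EuclideanSpace ℝ (Fin p))
    (t : ℝ) (θ : EuclideanSpace ℝ (Fin n)) : EuclideanSpace ℝ (Fin p) :=
  cylBilaplacian Φ t θ - fderiv ℝ (nonlinearity n p) (V t) (Φ t θ)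

/-! ### Indicial roots -/

/-- The Hölder space `C^{4,ζ}((0,∞) × 𝕊ⁿ⁻¹, ℝᵖ)`: derivatives up to order four exist and are
bounded, and those of order four are uniformly `ζ`-Hölder continuous. Derivatives are those of the
extension that is constant along rays. -/
def IsHolder {n p : ℕ} (ζ : ℝ)
    (Φ : ℝ → EuclideanSpace ℝ (Fin n) → EuclideanSpace ℝ (Fin p)) : Prop :=
  let F : ℝ × EuclideanSpace ℝ (Fin n) → EuclideanSpace ℝ (Fin p) :=
    fun q => radialExt (Φ q.1) q.2
  ContDiffOn ℝ 4 F {q | 0 < q.1 ∧ q.2 ≠ 0} ∧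
  ∃ C : ℝ,
    (∀ k : ℕ, k ≤ 4 → ∀ t : ℝ, 0 < t → ∀ θ : EuclideanSpace ℝ (Fin n), ‖θ‖ = 1 →
      ‖iteratedFDeriv ℝ k F (t, θ)‖ ≤ C) ∧
    (∀ s t : ℝ, 0 < s → 0 < t → ∀ ω θ : EuclideanSpace ℝ (Fin n), ‖ω‖ = 1 → ‖θ‖ = 1 →
      ‖iteratedFDeriv ℝ 4 F (s, ω) - iteratedFDeriv ℝ 4 F (t, θ)‖ ≤ C * dist (s, ω) (t, θ) ^ ζ)

/-- The `j`-th eigenvalue `λ_j = j(j+n-2)` of `-Δ_θ` on `𝕊ⁿ⁻¹` (without multiplicity). -/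
def sphEigenvalue (n j : ℕ) : ℝ := (j : ℝ) * ((j : ℝ) + (n : ℝ) - 2)

/-- `Φ(t,·)` lies, for every `t > 0`, in the `j`-th eigenspace of `-Δ_θ` (componentwise). -/
def InEigenspace {n p : ℕ} (j : ℕ)
    (Φ : ℝ → EuclideanSpace ℝ (Fin n) → EuclideanSpace ℝ (Fin p)) : Prop :=
  ∀ t : ℝ, 0 < t → ∀ θ : EuclideanSpace ℝ (Fin n), ‖θ‖ = 1 →
    sphLaplacian (Φ t) θ = -(sphEigenvalue n j • Φ t θ)

/-- `Φ ∈ C^{4,ζ}` takes values in the `j`-th eigenspace and, for some `β' < β`,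
`e^{-β' t} 𝓛(e^{β t} Φ) → 0` uniformly on the sphere as `t → ∞`, where `𝓛` is the linearization
at `V`. On such maps `𝓛` acts as its projection `𝓛_j`. -/
def IsApproxKernel {n p : ℕ} (ζ : ℝ) (V : ℝ → EuclideanSpace ℝ (Fin p)) (j : ℕ) (β : ℝ)
    (Φ : ℝ → EuclideanSpace ℝ (Fin n) → EuclideanSpace ℝ (Fin p)) : Prop :=
  IsHolder ζ Φ ∧ InEigenspace j Φ ∧
  ∃ β' : ℝ, β' < β ∧
    TendstoUniformlyOn
      (fun (t : ℝ) (θ : EuclideanSpace ℝ (Fin n)) =>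
        Real.exp (-(β' * t)) • linearized V (fun s ω => Real.exp (β * s) • Φ s ω) t θ)
      (fun _ => 0) atTop (sphere 0 1)

/-- The set of indicial roots: those `β` that have, for some `j`, an approximate kernel element
`Φ` with `limsup_{t → ∞} ‖Φ(t,·)‖_{L^∞(𝕊ⁿ⁻¹)} > 0`. -/
def indicialRoots (n : ℕ) {p : ℕ} (ζ : ℝ) (V : ℝ → EuclideanSpace ℝ (Fin p)) : Set ℝ :=
  {β | ∃ (j : ℕ) (Φ : ℝ → EuclideanSpace ℝ (Fin n) → EuclideanSpace ℝ (Fin p)),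
    IsApproxKernel ζ V j β Φ ∧
    ∃ δ : ℝ, 0 < δ ∧ ∃ᶠ t in atTop, ∃ θ : EuclideanSpace ℝ (Fin n), ‖θ‖ = 1 ∧ δ ≤ ‖Φ t θ‖}

/-- The indicial roots for which `Φ` can be chosen with
`liminf_{t → ∞} ‖Φ(t,·)‖_{L^∞(𝕊ⁿ⁻¹)} > 0`. -/
def strictIndicialRoots (n : ℕ) {p : ℕ} (ζ : ℝ) (V : ℝ → EuclideanSpace ℝ (Fin p)) : Set ℝ :=
  {β | ∃ (j : ℕ) (Φ : ℝ → EuclideanSpace ℝ (Fin n) → EuclideanSpace ℝ (Fin p)),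
    IsApproxKernel ζ V j β Φ ∧
    ∃ δ : ℝ, 0 < δ ∧ ∀ᶠ t in atTop, ∃ θ : EuclideanSpace ℝ (Fin n), ‖θ‖ = 1 ∧ δ ≤ ‖Φ t θ‖}

end EmdenFowler

end

namespace EmdenFowler

/-! ### Uniform estimates for scalar equations with an exponential weight -/

/-! On the `j`-th eigenspace the linearization is an ordinary differential operator in `t`. Its
constant-coefficient part has characteristic roots `±A`, `±B` with `A = j + n/2`, `B = j + γ`. The
derivative of the nonlinearity at `v Λ` multiplies `Λ` by `(2** - 1) c v^(2**-2)` and `Λ^⊥` by `c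
v^(2**-2)`. The component along `Λ` and the coordinates of the orthogonal part therefore satisfy
scalar fourth-order equations with one of these two potentials.

A weight `β` is not indicial if, for both potentials and every `j`, approximate solutions of size
`O(e^{βt})` are automatically `o(e^{βt})` (`IsRegularWeight`). There are two ways to see this. If
the potential is eventually small compared with `|A² - β²| |B² - β²|`, the constant-coefficient
operator is inverted one first-order factor at a time and the potential is absorbed by a contraction
(`IsWeightedJet.eventually_abs_le_of_potential_small`). This covers all large `j`, uniformly for
`|β| < 1/2`, and every `j` when `a = 0`, where the potential decays. If the potential is periodic,
Floquet theory applies: only `β = log|μ| / P`, with `μ` an eigenvalue of the monodromy map, can fail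
(`exists_finite_exceptional_weights`). Finitely many modes with finitely many exceptional weights
each leave an interval around `0` free of other roots.

That `0` is a root for `a > 0` comes from invariances. Translation in `t` gives the kernel element
`v' Λ`; for constant `v`, a cosine takes its place. Rotation of `Λ` gives `v e` with `e ⊥ Λ`. The
latter has norm at least `a`, hence the positive `liminf` when `p ≥ 2`. -/

/-- The common closing argument: any a priori bound, improved by a fixed factor `ρ < 1` and
iterated, becomes arbitrarily small. -/
theorem forall_pos_of_contraction {p : ℝ → Prop} {ρ L₀ : ℝ} (hρ0 : 0 < ρ) (hρ1 : ρ < 1)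
    (hmono : ∀ L L', L ≤ L' → p L → p L') (h₀ : p L₀) (hstep : ∀ L > 0, p L → p (ρ * L)) :
    ∀ ε > 0, p ε := by
  have hiter : ∀ k : ℕ, p (ρ ^ k * (|L₀| + 1)) := by
    intro k
    induction k with
    | zero => exact hmono _ _ (by have := le_abs_self L₀; linarith) h₀
    | succ k ih =>
      have := hstep _ (by positivity) ih
      rwa [← mul_assoc, ← pow_succ'] at this
  intro ε hε
  have hlim : Tendsto (fun k : ℕ => ρ ^ k * (|L₀| + 1)) atTop (𝓝 0) := by
    simpa using (tendsto_pow_atTop_nhds_zero_of_lt_one hρ0.le hρ1).mul_const (|L₀| + 1)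
  obtain ⟨k, hk⟩ := (hlim.eventually (gt_mem_nhds hε)).exists
  exact hmono _ _ hk.le (hiter k)

/-- The integrating factor makes `e^{-ks} (H/|k| - ψ s)` monotone. For `k < 0` it is compared with
its value at `t₁`, which yields the decaying transient; for `k > 0` it is compared with its limit
`0` at infinity, which exists because `ψ` is bounded. -/
theorem le_of_hasDerivAt_linear {ψ h : ℝ → ℝ} {k C H t₁ : ℝ} (hk : k ≠ 0)
    (hψ : ∀ t, t₁ ≤ t → HasDerivAt ψ (k * ψ t + h t) t)
    (hC : ∀ t, t₁ ≤ t → |ψ t| ≤ C) (hH : ∀ t, t₁ ≤ t → |h t| ≤ H) {t : ℝ} (ht : t₁ ≤ t) :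
    ψ t ≤ H / |k| + C * Real.exp (-|k| * (t - t₁)) := by
  have hC0 : 0 ≤ C := (abs_nonneg _).trans (hC t₁ le_rfl)
  have hH0 : 0 ≤ H := (abs_nonneg _).trans (hH t₁ le_rfl)
  set f : ℝ → ℝ := fun s => Real.exp (-k * s) * (H / |k| - ψ s) with hf
  have hf' : ∀ s, t₁ ≤ s → HasDerivAt f (Real.exp (-k * s) * (-k * (H / |k|) - h s)) s := by
    intro s hs
    have h1 : HasDerivAt (fun s : ℝ => Real.exp (-k * s)) (Real.exp (-k * s) * (-k)) s := by
      simpa using ((hasDerivAt_id s).const_mul (-k)).exp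
    have h2 := h1.mul ((hψ s hs).const_sub (H / |k|))
    refine h2.congr_deriv ?_
    ring
  have hcont : ContinuousOn f (Set.Ici t₁) := fun s hs =>
    (hf' s hs).continuousAt.continuousWithinAt
  rcases lt_or_gt_of_ne hk with hneg | hpos
  · have hmono : MonotoneOn f (Set.Ici t₁) := by
      apply monotoneOn_of_deriv_nonneg (convex_Ici t₁) hcont
      · intro s hs
        rw [interior_Ici] at hs
        exact (hf' s (le_of_lt hs)).differentiableAt.differentiableWithinAt
      · intro s hs
        rw [interior_Ici] at hs
        rw [(hf' s (le_of_lt hs)).deriv]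
        have : -k * (H / |k|) = H := by
          rw [abs_of_neg hneg]; field_simp
        rw [this]
        have := (abs_le.1 (hH s (le_of_lt hs))).2
        exact mul_nonneg (Real.exp_pos _).le (by linarith)
    have h1 := hmono (Set.self_mem_Ici) ht ht
    simp only [hf] at h1
    have h2 : -C ≤ H / |k| - ψ t₁ := by
      have := (abs_le.1 (hC t₁ le_rfl)).2
      have : 0 ≤ H / |k| := by positivity
      linarith
    have h3 : Real.exp (-k * t₁) * (-C) ≤ Real.exp (-k * t) * (H / |k| - ψ t) :=
      (mul_le_mul_of_nonneg_left h2 (Real.exp_pos _).le).trans h1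
    have h4 : Real.exp (-k * t₁) = Real.exp (-k * t) * Real.exp (-|k| * (t - t₁)) := by
      rw [← Real.exp_add, abs_of_neg hneg]; congr 1; ring
    rw [h4, mul_assoc] at h3
    have h5 := le_of_mul_le_mul_left h3 (Real.exp_pos _)
    linarith
  · have hanti : AntitoneOn f (Set.Ici t₁) := by
      apply antitoneOn_of_deriv_nonpos (convex_Ici t₁) hcont
      · intro s hs
        rw [interior_Ici] at hs
        exact (hf' s (le_of_lt hs)).differentiableAt.differentiableWithinAt
      · intro s hs
        rw [interior_Ici] at hs
        rw [(hf' s (le_of_lt hs)).deriv]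
        have : -k * (H / |k|) = -H := by
          rw [abs_of_pos hpos]; field_simp
        rw [this]
        have := (abs_le.1 (hH s (le_of_lt hs))).1
        exact mul_nonpos_of_nonneg_of_nonpos (Real.exp_pos _).le (by linarith)
    have hlim : Tendsto f atTop (𝓝 0) := by
      have h0 : Tendsto (fun s : ℝ => Real.exp (-k * s)) atTop (𝓝 0) :=
        Real.tendsto_exp_atBot.comp
          ((tendsto_const_mul_atBot_of_neg (by linarith : -k < 0)).2 tendsto_id)
      apply squeeze_zero_norm' (a := fun s => Real.exp (-k * s) * (H / |k| + C))
      · filter_upwards [eventually_ge_atTop t₁] with s hs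
        simp only [hf, norm_mul, Real.norm_eq_abs, Real.abs_exp]
        have h1 : 0 ≤ H / |k| := by positivity
        have h2 := abs_le.1 (hC s hs)
        exact mul_le_mul_of_nonneg_left (abs_le.2 ⟨by linarith, by linarith⟩) (Real.exp_pos _).le
      · simpa using h0.mul_const (H / |k| + C)
    have h0 : 0 ≤ f t := by
      apply le_of_tendsto hlim
      filter_upwards [eventually_ge_atTop t] with s hs
      exact hanti ht (le_trans ht hs) hs
    have h1 : 0 ≤ H / |k| - ψ t := nonneg_of_mul_nonneg_right h0 (Real.exp_pos _)
    have h2 : 0 ≤ C * Real.exp (-|k| * (t - t₁)) := by positivity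
    linarith

/-- Solutions of `z' = m z + h` of size `O(e^{β t})` with `m ≠ β` are controlled by `h`. -/
theorem eventually_abs_le_of_hasDerivAt_linear {Θ : Type*} {z h : Θ → ℝ → ℝ} {m β C H : ℝ}
    (hm : m ≠ β) (hH : 0 < H)
    (hz : ∀ θ t, 0 < t → HasDerivAt (z θ) (m * z θ t + h θ t) t)
    (hC : ∀ θ t, 0 < t → |z θ t| ≤ C * Real.exp (β * t))
    (hh : ∀ᶠ t in atTop, ∀ θ, |h θ t| ≤ H * Real.exp (β * t)) :
    ∀ᶠ t in atTop, ∀ θ, |z θ t| ≤ 2 * H / |m - β| * Real.exp (β * t) := by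
  obtain ⟨t₀, ht₀⟩ := eventually_atTop.1 hh
  set t₁ := max t₀ 1 with ht₁
  have ht₁0 : 0 < t₁ := lt_of_lt_of_le one_pos (le_max_right _ _)
  have hk : m - β ≠ 0 := sub_ne_zero.2 hm
  have hkpos : 0 < |m - β| := abs_pos.2 hk
  -- The transient dies out at a rate that does not depend on `θ`; the factor `2` in the conclusion
  -- absorbs what remains of it.
  have hlim : Tendsto (fun t : ℝ => C * Real.exp (-|m - β| * (t - t₁))) atTop (𝓝 0) := by
    have h0 : Tendsto (fun t : ℝ => -|m - β| * (t - t₁)) atTop atBot :=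
      (tendsto_const_mul_atBot_of_neg (by linarith)).2 (tendsto_atTop_add_const_right _ _ tendsto_id)
    simpa using (Real.tendsto_exp_atBot.comp h0).const_mul C
  have hsmall := hlim.eventually (gt_mem_nhds (show 0 < H / |m - β| by positivity))
  filter_upwards [hsmall, eventually_ge_atTop t₁] with t htε ht θ
  -- The renormalized function `e^{-βt} z` has rate `m - β`; the one-sided estimate is applied to it
  -- with both signs.
  have key : ∀ σ : ℝ, |σ| = 1 → σ * (Real.exp (-(β * t)) * z θ t) ≤ 2 * H / |m - β| := by
    intro σ hσ
    have h1 := le_of_hasDerivAt_linear (ψ := fun s => σ * (Real.exp (-(β * s)) * z θ s))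
      (h := fun s => σ * (Real.exp (-(β * s)) * h θ s)) (C := C) (H := H) (t₁ := t₁) hk
      (fun s hs => by
        have h1 : HasDerivAt (fun s : ℝ => Real.exp (-(β * s))) (Real.exp (-(β * s)) * (-β)) s := by
          simpa using ((hasDerivAt_id s).const_mul β).neg.exp
        refine HasDerivAt.congr_deriv ((h1.mul (hz θ s (ht₁0.trans_le hs))).const_mul σ) ?_
        ring_nf)
      (fun s hs => by
        rw [abs_mul, hσ, one_mul, abs_mul, Real.abs_exp, Real.exp_neg, inv_mul_le_iff₀
          (Real.exp_pos _), mul_comm]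
        exact hC θ s (ht₁0.trans_le hs))
      (fun s hs => by
        rw [abs_mul, hσ, one_mul, abs_mul, Real.abs_exp, Real.exp_neg, inv_mul_le_iff₀
          (Real.exp_pos _), mul_comm]
        exact ht₀ s ((le_max_left _ _).trans hs) θ) ht
    have h2 : 2 * H / |m - β| = H / |m - β| + H / |m - β| := by ring
    linarith
  have h1 := key 1 (by simp)
  have h2 := key (-1) (by simp)
  have h3 : |Real.exp (-(β * t)) * z θ t| ≤ 2 * H / |m - β| := abs_le.2 ⟨by linarith, by linarith⟩
  rwa [abs_mul, Real.abs_exp, Real.exp_neg, inv_mul_le_iff₀ (Real.exp_pos _), mul_comm] at h3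

/-- `U k θ`, `k ≤ 4`, are the derivatives on `(0, ∞)` of a family of functions `U 0 θ`
that is `O(e^{β t})`, together with its derivatives of order at most three. -/
structure IsWeightedJet {Θ : Type*} (β C : ℝ) (U : ℕ → Θ → ℝ → ℝ) : Prop where
  hasDerivAt : ∀ k < 4, ∀ θ t, 0 < t → HasDerivAt (U k θ) (U (k + 1) θ t) t
  bound : ∀ k < 4, ∀ θ t, 0 < t → |U k θ t| ≤ C * Real.exp (β * t)

/-- Perturbation of a constant coefficient equation with characteristic roots `±A`, `±B`, at a
weight which is not one of these roots. -/
theorem IsWeightedJet.eventually_abs_le_of_potential_small {Θ : Type*} {β C A B w : ℝ}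
    {U : ℕ → Θ → ℝ → ℝ} (hU : IsWeightedJet β C U) {W : ℝ → ℝ}
    (hA : A ^ 2 ≠ β ^ 2) (hB : B ^ 2 ≠ β ^ 2)
    (hw : 32 * w ≤ |A ^ 2 - β ^ 2| * |B ^ 2 - β ^ 2|) (hw0 : 0 ≤ w)
    (hW : ∀ᶠ t in atTop, |W t| ≤ w)
    (hg : ∀ ε > 0, ∀ᶠ t in atTop, ∀ θ, |U 4 θ t - (A ^ 2 + B ^ 2) * U 2 θ t
      + (A ^ 2 * B ^ 2 - W t) * U 0 θ t| ≤ ε * Real.exp (β * t)) :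
    ∀ ε > 0, ∀ᶠ t in atTop, ∀ θ, |U 0 θ t| ≤ ε * Real.exp (β * t) := by
  have hA1 : A ≠ β := fun h => hA (by rw [h])
  have hA2 : -A ≠ β := fun h => hA (by rw [← h]; ring)
  have hB1 : B ≠ β := fun h => hB (by rw [h])
  have hB2 : -B ≠ β := fun h => hB (by rw [← h]; ring)
  have b0 := hU.bound 0 (by norm_num)
  have b1 := hU.bound 1 (by norm_num)
  have b2 := hU.bound 2 (by norm_num)
  have b3 := hU.bound 3 (by norm_num)
  have d0 := hU.hasDerivAt 0 (by norm_num)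
  have d1 := hU.hasDerivAt 1 (by norm_num)
  have d2 := hU.hasDerivAt 2 (by norm_num)
  have d3 := hU.hasDerivAt 3 (by norm_num)
  -- Invert `(D - A)(D + A)(D - B)(D + B)` factor by factor. Each factor with root `m` costs `2 / |m
  -- - β|`, and none of the roots equals `β`.
  have hinv : ∀ H > 0, (∀ᶠ t in atTop, ∀ θ, |U 4 θ t - (A ^ 2 + B ^ 2) * U 2 θ t
      + A ^ 2 * B ^ 2 * U 0 θ t| ≤ H * Real.exp (β * t)) →
      ∀ᶠ t in atTop, ∀ θ, |U 0 θ t| ≤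
        2 * (2 * (2 * (2 * H / |A - β|) / |-A - β|) / |B - β|) / |-B - β| * Real.exp (β * t) := by
    intro H hH hev
    have pA1 : 0 < |A - β| := abs_pos.2 (sub_ne_zero.2 hA1)
    have pA2 : 0 < |-A - β| := abs_pos.2 (sub_ne_zero.2 hA2)
    have pB1 : 0 < |B - β| := abs_pos.2 (sub_ne_zero.2 hB1)
    have e3 := eventually_abs_le_of_hasDerivAt_linear
      (z := fun θ t => U 3 θ t + A * U 2 θ t - B ^ 2 * U 1 θ t - A * B ^ 2 * U 0 θ t)
      (C := C + |A| * C + B ^ 2 * C + |A| * B ^ 2 * C) hA1 hH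
      (h := fun θ t => U 4 θ t - (A ^ 2 + B ^ 2) * U 2 θ t + A ^ 2 * B ^ 2 * U 0 θ t)
      (fun θ t ht => by
        refine HasDerivAt.congr_deriv ((((d3 θ t ht).add ((d2 θ t ht).const_mul A)).sub
          ((d1 θ t ht).const_mul (B ^ 2))).sub ((d0 θ t ht).const_mul (A * B ^ 2))) ?_
        ring_nf)
      (fun θ t ht => by
        have i3 := b3 θ t ht
        have i2 := mul_le_mul_of_nonneg_left (b2 θ t ht) (abs_nonneg A)
        have i1 := mul_le_mul_of_nonneg_left (b1 θ t ht) (sq_nonneg B)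
        have i0 := mul_le_mul_of_nonneg_left (b0 θ t ht) (by positivity : 0 ≤ |A| * B ^ 2)
        have : |U 3 θ t + A * U 2 θ t - B ^ 2 * U 1 θ t - A * B ^ 2 * U 0 θ t|
            ≤ |U 3 θ t| + |A| * |U 2 θ t| + B ^ 2 * |U 1 θ t| + |A| * B ^ 2 * |U 0 θ t| := by
          refine (abs_sub _ _).trans (add_le_add ((abs_sub _ _).trans (add_le_add
            ((abs_add_le _ _).trans (add_le_add le_rfl ?_)) ?_)) ?_) <;> simp [abs_mul]
        linarith)
      hev
    have e2 := eventually_abs_le_of_hasDerivAt_linear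
      (z := fun θ t => U 2 θ t - B ^ 2 * U 0 θ t)
      (C := C + B ^ 2 * C) hA2 (by positivity)
      (fun θ t ht => by
        refine HasDerivAt.congr_deriv ((d2 θ t ht).sub ((d0 θ t ht).const_mul (B ^ 2))) ?_
        ring_nf)
      (fun θ t ht => by
        have i2 := b2 θ t ht
        have i0 := mul_le_mul_of_nonneg_left (b0 θ t ht) (sq_nonneg B)
        have : |U 2 θ t - B ^ 2 * U 0 θ t| ≤ |U 2 θ t| + B ^ 2 * |U 0 θ t| := by
          refine (abs_sub _ _).trans (add_le_add le_rfl ?_); simp [abs_mul]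
        linarith)
      e3
    have e1 := eventually_abs_le_of_hasDerivAt_linear
      (z := fun θ t => U 1 θ t + B * U 0 θ t)
      (C := C + |B| * C) hB1 (by positivity)
      (fun θ t ht => by
        refine HasDerivAt.congr_deriv ((d1 θ t ht).add ((d0 θ t ht).const_mul B)) ?_
        ring_nf)
      (fun θ t ht => by
        have i2 := b1 θ t ht
        have i0 := mul_le_mul_of_nonneg_left (b0 θ t ht) (abs_nonneg B)
        have : |U 1 θ t + B * U 0 θ t| ≤ |U 1 θ t| + |B| * |U 0 θ t| := by
          refine (abs_add_le _ _).trans (add_le_add le_rfl ?_); simp [abs_mul]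
        linarith)
      e2
    exact eventually_abs_le_of_hasDerivAt_linear
      (z := fun θ t => U 0 θ t) (C := C) hB2 (by positivity)
      (fun θ t ht => by
        refine HasDerivAt.congr_deriv (d0 θ t ht) ?_
        ring_nf)
      b0 e1
  set Q := |A ^ 2 - β ^ 2| * |B ^ 2 - β ^ 2| with hQ
  have hQ0 : 0 < Q := mul_pos (abs_pos.2 (sub_ne_zero.2 hA)) (abs_pos.2 (sub_ne_zero.2 hB))
  have hconst : ∀ H, 2 * (2 * (2 * (2 * H / |A - β|) / |-A - β|) / |B - β|) / |-B - β|
      = 16 * H / Q := by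
    intro H
    have h1 : |A ^ 2 - β ^ 2| = |A - β| * |-A - β| := by
      rw [← abs_mul, ← abs_neg]; congr 1; ring
    have h2 : |B ^ 2 - β ^ 2| = |B - β| * |-B - β| := by
      rw [← abs_mul, ← abs_neg]; congr 1; ring
    rw [hQ, h1, h2]
    simp only [mul_div_assoc', div_div]
    congr 1 <;> ring
  -- The inverse has norm `16 / Q`. The potential contributes at most `16 w L / Q ≤ L/2` and the
  -- error term `16 (Q/64) L / Q = L/4`, whence the ratio `3/4`.
  have hstep : ∀ L > 0, (∀ᶠ t in atTop, ∀ θ, |U 0 θ t| ≤ L * Real.exp (β * t)) →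
      ∀ᶠ t in atTop, ∀ θ, |U 0 θ t| ≤ 3 / 4 * L * Real.exp (β * t) := by
    intro L hL hev
    have hLQ : 0 < Q / 64 * L := by positivity
    have h1 := hinv (w * L + Q / 64 * L) (by positivity) (by
      filter_upwards [hev, hW, hg _ hLQ] with t h1 h2 h3 θ
      have h4 : |W t * U 0 θ t| ≤ w * (L * Real.exp (β * t)) := by
        rw [abs_mul]; exact mul_le_mul h2 (h1 θ) (abs_nonneg _) hw0
      have h5 := abs_add_le (U 4 θ t - (A ^ 2 + B ^ 2) * U 2 θ t
        + (A ^ 2 * B ^ 2 - W t) * U 0 θ t) (W t * U 0 θ t)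
      have h6 := h3 θ
      have h7 : U 4 θ t - (A ^ 2 + B ^ 2) * U 2 θ t + A ^ 2 * B ^ 2 * U 0 θ t
        = U 4 θ t - (A ^ 2 + B ^ 2) * U 2 θ t
        + (A ^ 2 * B ^ 2 - W t) * U 0 θ t + W t * U 0 θ t := by ring
      rw [h7]
      linarith)
    filter_upwards [h1] with t ht θ
    refine (ht θ).trans (mul_le_mul_of_nonneg_right ?_ (Real.exp_pos _).le)
    rw [hconst, div_le_iff₀ hQ0]
    nlinarith
  refine forall_pos_of_contraction
    (p := fun L => ∀ᶠ t in atTop, ∀ θ, |U 0 θ t| ≤ L * Real.exp (β * t))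
    (ρ := 3 / 4) (L₀ := C) (by norm_num) (by norm_num) ?_ ?_ hstep
  · intro L L' hL h
    filter_upwards [h] with t ht θ
    exact (ht θ).trans (mul_le_mul_of_nonneg_right hL (Real.exp_pos _).le)
  · filter_upwards [eventually_gt_atTop 0] with t ht θ
    exact b0 θ t ht

end EmdenFowler

namespace EmdenFowler

/-! ### Linear systems with periodic coefficients -/

/-- If `‖μ‖ < r`, the recurrence read forwards improves the constant; if `‖μ‖ > r`, it is solved for
`z k` and read backwards. The tolerance is half the gap between `‖μ‖` and `r`. -/
theorem eventually_norm_le_of_scalar_recurrence {Θ E : Type*} [NormedAddCommGroup E]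
    [NormedSpace ℂ E] {z : ℕ → Θ → E} {μ : ℂ} {r C : ℝ} (hr : 0 < r) (hμ : ‖μ‖ ≠ r)
    (hC : ∀ᶠ k in atTop, ∀ θ, ‖z k θ‖ ≤ C * r ^ k)
    (hz : ∀ ε > 0, ∀ᶠ k in atTop, ∀ θ, ‖z (k + 1) θ - μ • z k θ‖ ≤ ε * r ^ k) :
    ∀ ε > 0, ∀ᶠ k in atTop, ∀ θ, ‖z k θ‖ ≤ ε * r ^ k := by
  have hmono : ∀ L L', L ≤ L' → (∀ᶠ k in atTop, ∀ θ, ‖z k θ‖ ≤ L * r ^ k) →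
      ∀ᶠ k in atTop, ∀ θ, ‖z k θ‖ ≤ L' * r ^ k := by
    intro L L' hL h
    filter_upwards [h] with k hk θ
    exact (hk θ).trans (mul_le_mul_of_nonneg_right hL (by positivity))
  rcases lt_or_gt_of_ne hμ with hlt | hgt
  · have hm0 := norm_nonneg μ
    refine forall_pos_of_contraction (p := fun L => ∀ᶠ k in atTop, ∀ θ, ‖z k θ‖ ≤ L * r ^ k)
      (ρ := (‖μ‖ + r) / (2 * r)) (by positivity)
      (by rw [div_lt_one (by positivity)]; linarith) hmono hC ?_
    intro L hL hev
    have h1 : ∀ᶠ k in atTop, ∀ θ, ‖z (k + 1) θ‖ ≤ (‖μ‖ + r) / (2 * r) * L * r ^ (k + 1) := by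
      filter_upwards [hev, hz ((r - ‖μ‖) / 2 * L) (mul_pos (by linarith) hL)] with k h1 h2 θ
      have h3 : ‖z (k + 1) θ‖ ≤ ‖z (k + 1) θ - μ • z k θ‖ + ‖μ • z k θ‖ := by
        simpa using norm_add_le (z (k + 1) θ - μ • z k θ) (μ • z k θ)
      rw [norm_smul] at h3
      have h4 := mul_le_mul_of_nonneg_left (h1 θ) hm0
      have h5 : (‖μ‖ + r) / (2 * r) * L * r ^ (k + 1) = (‖μ‖ + r) / 2 * L * r ^ k := by
        rw [pow_succ]; field_simp
      rw [h5]
      have := h2 θ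
      nlinarith
    obtain ⟨k₀, hk₀⟩ := eventually_atTop.1 h1
    filter_upwards [eventually_ge_atTop (k₀ + 1)] with k hk
    obtain ⟨m, rfl⟩ : ∃ m, k = m + 1 := ⟨k - 1, by omega⟩
    exact hk₀ m (by omega)
  · have hm0 : 0 < ‖μ‖ := hr.trans hgt
    refine forall_pos_of_contraction (p := fun L => ∀ᶠ k in atTop, ∀ θ, ‖z k θ‖ ≤ L * r ^ k)
      (ρ := (‖μ‖ + r) / (2 * ‖μ‖)) (by positivity)
      (by rw [div_lt_one (by positivity)]; linarith) hmono hC ?_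
    intro L hL hev
    filter_upwards [(tendsto_add_atTop_nat 1).eventually hev,
      hz ((‖μ‖ - r) / 2 * L) (mul_pos (by linarith) hL)] with k h1 h2 θ
    have h3 : ‖μ • z k θ‖ ≤ ‖z (k + 1) θ‖ + ‖z (k + 1) θ - μ • z k θ‖ := by
      simpa using norm_sub_le (z (k + 1) θ) (z (k + 1) θ - μ • z k θ)
    rw [norm_smul] at h3
    have h4 := h1 θ
    have h5 := h2 θ
    have h6 : (‖μ‖ + r) / (2 * ‖μ‖) * L * r ^ k = ((‖μ‖ + r) / 2 * L * r ^ k) / ‖μ‖ := by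
      field_simp
    rw [h6, le_div_iff₀ hm0]
    rw [pow_succ] at h4
    nlinarith

open Polynomial in
-- Cayley–Hamilton replaces a Jordan decomposition: the product of all `M - μ` annihilates `y k`,
-- and the factors are removed one at a time. If `(M - μ) q(M) y` is small, then `q(M) y` satisfies
-- an approximate scalar recurrence with multiplier `μ`.
theorem eventually_norm_le_of_recurrence {Θ E : Type*} [NormedAddCommGroup E]
    [NormedSpace ℂ E] [FiniteDimensional ℂ E] {M : Module.End ℂ E} {r : ℝ} (hr : 0 < r)
    (hM : ∀ μ ∈ M.charpoly.roots, ‖μ‖ ≠ r) {y : ℕ → Θ → E} {C : ℝ}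
    (hC : ∀ᶠ k in atTop, ∀ θ, ‖y k θ‖ ≤ C * r ^ k)
    (hy : ∀ ε > 0, ∀ᶠ k in atTop, ∀ θ, ‖y (k + 1) θ - M (y k θ)‖ ≤ ε * r ^ k) :
    ∀ ε > 0, ∀ᶠ k in atTop, ∀ θ, ‖y k θ‖ ≤ ε * r ^ k := by
  have hbound : ∀ B : Module.End ℂ E, ∃ b : ℝ, 0 < b ∧ ∀ x, ‖B x‖ ≤ b * ‖x‖ := by
    intro B
    refine ⟨‖LinearMap.toContinuousLinearMap B‖ + 1, by positivity, fun x => ?_⟩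
    refine ((LinearMap.toContinuousLinearMap B).le_opNorm x).trans ?_
    exact mul_le_mul_of_nonneg_right (by linarith) (norm_nonneg _)
  have key : ∀ s : Multiset ℂ, (∀ μ ∈ s, ‖μ‖ ≠ r) →
      (∀ ε > 0, ∀ᶠ k in atTop, ∀ θ,
        ‖aeval M (s.map fun μ => (X - Polynomial.C μ : ℂ[X])).prod (y k θ)‖ ≤ ε * r ^ k) →
      ∀ ε > 0, ∀ᶠ k in atTop, ∀ θ, ‖y k θ‖ ≤ ε * r ^ k := by
    intro s
    induction s using Multiset.induction_on with
    | empty => intro _ h; simpa using h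
    | cons μ s ih =>
      intro hs h
      refine ih (fun ν hν => hs ν (Multiset.mem_cons_of_mem hν)) ?_
      set q : ℂ[X] := (s.map fun μ => (X - Polynomial.C μ : ℂ[X])).prod with hq
      obtain ⟨b, hb0, hb⟩ := hbound (aeval M q)
      refine eventually_norm_le_of_scalar_recurrence (z := fun k θ => aeval M q (y k θ)) (μ := μ)
        (C := b * C) hr (hs μ (Multiset.mem_cons_self _ _)) ?_ ?_
      · filter_upwards [hC] with k hk θ
        refine (hb _).trans ?_
        rw [mul_assoc]
        exact mul_le_mul_of_nonneg_left (hk θ) hb0.le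
      · intro ε hε
        filter_upwards [h (ε / 2) (by positivity), hy (ε / 2 / b) (by positivity)] with k h1 h2 θ
        have hsplit : aeval M q (y (k + 1) θ) - μ • aeval M q (y k θ)
            = aeval M q (y (k + 1) θ - M (y k θ))
              + aeval M ((Multiset.map (fun μ => (X - Polynomial.C μ : ℂ[X])) (μ ::ₘ s)).prod)
                (y k θ) := by
          rw [Multiset.map_cons, Multiset.prod_cons, ← hq, mul_comm]
          simp [map_sub, mul_sub, Algebra.algebraMap_eq_smul_one]
        rw [hsplit]
        refine (norm_add_le _ _).trans ?_
        have h3 := (hb (y (k + 1) θ - M (y k θ))).trans (mul_le_mul_of_nonneg_left (h2 θ) hb0.le)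
        have h4 : b * (ε / 2 / b * r ^ k) = ε / 2 * r ^ k := by field_simp
        have h5 := h1 θ
        linarith
  refine key M.charpoly.roots hM ?_
  have hch : (M.charpoly.roots.map fun μ => (X - Polynomial.C μ : ℂ[X])).prod = M.charpoly :=
    ((IsAlgClosed.splits M.charpoly).eq_prod_roots_of_monic (LinearMap.charpoly_monic M)).symm
  rw [hch, LinearMap.aeval_self_charpoly]
  intro ε hε
  filter_upwards with k θ
  simp only [LinearMap.zero_apply, norm_zero]
  positivity

theorem gronwallBound_eq_add (δ K ε x : ℝ) :
    gronwallBound δ K ε x = δ * Real.exp (K * x) + ε * gronwallBound 0 K 1 x := by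
  by_cases hK : K = 0
  · simp [gronwallBound, hK]
  · simp only [gronwallBound, if_neg hK]; ring

theorem gronwallBound_zero_nonneg {K x : ℝ} (hK : 0 ≤ K) (hx : 0 ≤ x) :
    0 ≤ gronwallBound 0 K 1 x := by
  have := gronwallBound_mono (le_refl (0 : ℝ)) zero_le_one hK hx
  rwa [gronwallBound_x0] at this

/-! ### Approximate propagators and the monodromy map -/

section LinearSystem

variable {E : Type*} [NormedAddCommGroup E] [NormedSpace ℂ E]

/-- `M` and `D` describe the solutions of `x' = A x + g` on `[s, t]`:
the final value is `M (x s)` up to an error of size `D * sup ‖g‖`. -/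
def IsApproxPropagator (A : ℝ → E →L[ℂ] E) (s t : ℝ) (M : E →L[ℂ] E) (D : ℝ) : Prop :=
  ∀ (x x' : ℝ → E) (ε : ℝ), (∀ τ ∈ Set.Icc s t, HasDerivWithinAt x (x' τ) (Set.Icc s t) τ) →
    (∀ τ ∈ Set.Icc s t, ‖x' τ - A τ (x τ)‖ ≤ ε) → ‖x t - M (x s)‖ ≤ D * ε

theorem IsApproxPropagator.comp {A : ℝ → E →L[ℂ] E} {r s t D₁ D₂ : ℝ} {M₁ M₂ : E →L[ℂ] E}
    (hrs : r ≤ s) (hst : s ≤ t)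
    (h₁ : IsApproxPropagator A r s M₁ D₁) (h₂ : IsApproxPropagator A s t M₂ D₂) :
    IsApproxPropagator A r t (M₂ ∘L M₁) (D₂ + ‖M₂‖ * D₁) := by
  intro x x' ε hx hg
  have hsub₁ : Set.Icc r s ⊆ Set.Icc r t := Set.Icc_subset_Icc le_rfl hst
  have hsub₂ : Set.Icc s t ⊆ Set.Icc r t := Set.Icc_subset_Icc hrs le_rfl
  have e₁ := h₁ x x' ε (fun τ hτ => (hx τ (hsub₁ hτ)).mono hsub₁) (fun τ hτ => hg τ (hsub₁ hτ))
  have e₂ := h₂ x x' ε (fun τ hτ => (hx τ (hsub₂ hτ)).mono hsub₂) (fun τ hτ => hg τ (hsub₂ hτ))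
  have e₃ := (M₂.le_opNorm (x s - M₁ (x r))).trans
    (mul_le_mul_of_nonneg_left e₁ (norm_nonneg _))
  have : x t - (M₂ ∘L M₁) (x r) = (x t - M₂ (x s)) + M₂ (x s - M₁ (x r)) := by simp
  rw [this]
  refine (norm_add_le _ _).trans ?_
  linarith

variable [FiniteDimensional ℂ E]

/-- Picard–Lindelöf on the ball of radius `‖x₀‖` about `x₀`, where the field is at most `2K‖x₀‖`, so
`K h ≤ 1/2` suffices for every `x₀`. Grönwall compares exact and approximate solutions; with zero
error it also gives the uniqueness that makes the flow linear. -/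
theorem exists_isApproxPropagator_short {A : ℝ → E →L[ℂ] E} (hA : Continuous A) {K : NNReal}
    (hK : ∀ t, ‖A t‖ ≤ K) {s h : ℝ} (hh : 0 ≤ h) (hKh : K * h ≤ 1 / 2) :
    ∃ M : E →L[ℂ] E, ∃ D : ℝ, IsApproxPropagator A s (s + h) M D := by
  have : CompleteSpace E := FiniteDimensional.complete ℂ E
  have hsm : s ∈ Set.Icc s (s + h) := ⟨le_rfl, by linarith⟩
  have hLip : ∀ t, LipschitzWith K (fun x => A t x) := fun t =>
    (A t).lipschitz.weaken (by exact_mod_cast hK t)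
  have hex : ∀ x₀ : E, ∃ α : ℝ → E, α s = x₀ ∧
      ∀ t ∈ Set.Icc s (s + h), HasDerivWithinAt α (A t (α t)) (Set.Icc s (s + h)) t := by
    intro x₀
    have hPL : IsPicardLindelof (fun t x => A t x) (⟨s, hsm⟩ : Set.Icc s (s + h)) x₀
        ‖x₀‖₊ 0 (K * (2 * ‖x₀‖₊)) K := by
      refine ⟨fun t _ => (hLip t).lipschitzOnWith, fun x _ => ?_, fun t _ x hx => ?_, ?_⟩
      · exact (hA.clm_apply continuous_const).continuousOn
      · have hx' : ‖x‖ ≤ 2 * ‖x₀‖ := by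
          have h1 : ‖x - x₀‖ ≤ ‖x₀‖ := by simpa [dist_eq_norm] using hx
          have h2 : ‖x‖ ≤ ‖x - x₀‖ + ‖x₀‖ := by simpa using norm_add_le (x - x₀) x₀
          linarith
        push_cast
        exact ((A t).le_opNorm x).trans (mul_le_mul (hK t) hx' (norm_nonneg _) K.2)
      · have : max (s + h - s) (s - s) = h := by
          rw [add_sub_cancel_left, sub_self]; exact max_eq_left hh
        push_cast
        rw [this]
        have := mul_le_mul_of_nonneg_right hKh (norm_nonneg x₀)
        linarith
    exact hPL.exists_eq_forall_mem_Icc_hasDerivWithinAt₀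
  choose α hα₀ hα using hex
  have hIci : ∀ {f : ℝ → E} {f' : E} {t : ℝ}, t ∈ Set.Ico s (s + h) →
      HasDerivWithinAt f f' (Set.Icc s (s + h)) t → HasDerivWithinAt f f' (Set.Ici t) t := by
    intro f f' t ht hf
    refine hf.mono_of_mem_nhdsWithin ?_
    exact mem_of_superset (Icc_mem_nhdsGE ht.2) (Set.Icc_subset_Icc ht.1 le_rfl)
  have happrox : ∀ (x x' : ℝ → E) (ε : ℝ),
      (∀ τ ∈ Set.Icc s (s + h), HasDerivWithinAt x (x' τ) (Set.Icc s (s + h)) τ) →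
      (∀ τ ∈ Set.Icc s (s + h), ‖x' τ - A τ (x τ)‖ ≤ ε) →
      ‖x (s + h) - α (x s) (s + h)‖ ≤ gronwallBound 0 K 1 h * ε := by
    intro x x' ε hx hg
    have := dist_le_of_approx_trajectories_ODE (v := fun t x => A t x) (K := K) (a := s)
      (b := s + h) (εf := ε) (εg := 0) (δ := 0) (f := x) (g := α (x s)) hLip
      (fun t ht => (hx t ht).continuousWithinAt)
      (fun t ht => hIci ht (hx t (Set.Ico_subset_Icc_self ht)))
      (fun t ht => by simpa [dist_eq_norm] using hg t (Set.Ico_subset_Icc_self ht))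
      (fun t ht => (hα (x s) t ht).continuousWithinAt)
      (fun t ht => hIci ht (hα (x s) t (Set.Ico_subset_Icc_self ht)))
      (fun t ht => by simp) (by simp [hα₀]) (s + h) ⟨by linarith, le_rfl⟩
    rw [dist_eq_norm, gronwallBound_eq_add] at this
    simpa [mul_comm] using this
  have hexact : ∀ x : ℝ → E,
      (∀ τ ∈ Set.Icc s (s + h), HasDerivWithinAt x (A τ (x τ)) (Set.Icc s (s + h)) τ) →
      α (x s) (s + h) = x (s + h) := by
    intro x hx
    have := happrox x (fun τ => A τ (x τ)) 0 hx (by simp)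
    rw [mul_zero, norm_le_zero_iff, sub_eq_zero] at this
    exact this.symm
  let M : E →ₗ[ℂ] E :=
    { toFun := fun x₀ => α x₀ (s + h)
      map_add' := fun a b => by
        have := hexact (α a + α b) (fun τ hτ => by
          simpa using (hα a τ hτ).add (hα b τ hτ))
        simpa [hα₀] using this
      map_smul' := fun z a => by
        have := hexact (z • α a) (fun τ hτ => by
          simpa using (hα a τ hτ).const_smul z)
        simpa [hα₀] using this }
  exact ⟨LinearMap.toContinuousLinearMap M, gronwallBound 0 K 1 h, happrox⟩

theorem exists_isApproxPropagator {A : ℝ → E →L[ℂ] E} (hA : Continuous A) {K : NNReal}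
    (hK : ∀ t, ‖A t‖ ≤ K) {P : ℝ} (hP : 0 < P) :
    ∃ M : E →L[ℂ] E, ∃ D : ℝ, IsApproxPropagator A 0 P M D := by
  obtain ⟨N, hN⟩ := exists_nat_gt (2 * (K * P))
  have hN0 : (0 : ℝ) < N := lt_of_le_of_lt (by positivity) hN
  set h := P / N with hh
  have hh0 : 0 ≤ h := by positivity
  have hKh : K * h ≤ 1 / 2 := by
    rw [hh, mul_div_assoc', div_le_iff₀ hN0]; linarith
  have hall : ∀ i : ℕ, ∃ M : E →L[ℂ] E, ∃ D : ℝ, IsApproxPropagator A 0 (i * h) M D := by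
    intro i
    induction i with
    | zero =>
      refine ⟨ContinuousLinearMap.id ℂ E, 0, fun x x' ε _ _ => ?_⟩
      simp
    | succ i ih =>
      obtain ⟨M₁, D₁, h₁⟩ := ih
      obtain ⟨M₂, D₂, h₂⟩ := exists_isApproxPropagator_short hA hK (s := i * h) hh0 hKh
      have he : ((i + 1 : ℕ) : ℝ) * h = i * h + h := by push_cast; ring
      rw [he]
      exact ⟨_, _, h₁.comp (by positivity) (by linarith) h₂⟩
  have := hall N
  rwa [hh, mul_div_cancel₀ _ hN0.ne'] at this

end LinearSystem

end EmdenFowler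

/-! ### Floquet theory: finitely many exceptional weights -/

namespace EmdenFowler

theorem exists_norm_le_of_periodic {F : Type*} [NormedAddCommGroup F] {f : ℝ → F}
    (hf : Continuous f) {P : ℝ} (hP : 0 < P) (hper : Function.Periodic f P) :
    ∃ K : ℝ, 0 ≤ K ∧ ∀ t, ‖f t‖ ≤ K := by
  obtain ⟨K, hK⟩ := (isCompact_Icc (a := (0 : ℝ)) (b := P)).exists_bound_of_continuousOn
    hf.continuousOn
  refine ⟨K, (norm_nonneg _).trans (hK 0 ⟨le_rfl, hP.le⟩), fun t => ?_⟩
  obtain ⟨s, hs, hst⟩ := hper.exists_mem_Ico₀ hP t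
  rw [hst]
  exact hK s (Set.Ico_subset_Icc_self hs)

/-- For a linear system with `P`-periodic coefficients and all but finitely many weights `β`,
approximate solutions of size `O(e^{β t})` are `o(e^{β t})`. -/
theorem exists_finite_exceptional_weights_system {E : Type*} [NormedAddCommGroup E]
    [NormedSpace ℂ E] [FiniteDimensional ℂ E] {A : ℝ → E →L[ℂ] E} (hA : Continuous A)
    {P : ℝ} (hP : 0 < P) (hper : Function.Periodic A P) :
    ∃ S : Set ℝ, S.Finite ∧ ∀ β ∉ S, ∀ (Θ : Type) (x x' : Θ → ℝ → E) (C : ℝ),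
      (∀ θ t, 0 < t → HasDerivAt (x θ) (x' θ t) t) →
      (∀ θ t, 0 < t → ‖x θ t‖ ≤ C * Real.exp (β * t)) →
      (∀ ε > 0, ∀ᶠ t in atTop, ∀ θ, ‖x' θ t - A t (x θ t)‖ ≤ ε * Real.exp (β * t)) →
      ∀ ε > 0, ∀ᶠ t in atTop, ∀ θ, ‖x θ t‖ ≤ ε * Real.exp (β * t) := by
  obtain ⟨K, hK0, hK⟩ := exists_norm_le_of_periodic hA hP hper
  obtain ⟨M, D, hMD⟩ := exists_isApproxPropagator (K := ⟨K, hK0⟩) hA hK hP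
  -- Real parts of the Floquet exponents. Since `Real.log 0 = 0`, a zero eigenvalue could only
  -- enlarge the set.
  refine ⟨(fun μ : ℂ => Real.log ‖μ‖ / P) '' (M.toLinearMap.charpoly.roots.toFinset : Set ℂ),
    (Finset.finite_toSet _).image _, ?_⟩
  intro β hβ Θ x x' C hx hC hg
  set r := Real.exp (β * P) with hr
  have hr0 : 0 < r := Real.exp_pos _
  have hrk : ∀ k : ℕ, Real.exp (β * (k * P)) = r ^ k := by
    intro k; rw [hr, ← Real.exp_nat_mul]; congr 1; ring
  have hroots : ∀ μ ∈ M.toLinearMap.charpoly.roots, ‖μ‖ ≠ r := by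
    intro μ hμ h
    refine hβ ⟨μ, by simpa using hμ, ?_⟩
    simp only [h, hr, Real.log_exp]
    field_simp
  have hloc : ∀ (k : ℕ) (t : ℝ), t ∈ Set.Icc ((k : ℝ) * P) (k * P + P) →
      Real.exp (β * t) ≤ Real.exp (|β| * P) * r ^ k ∧
      r ^ k ≤ Real.exp (|β| * P) * Real.exp (β * t) := by
    intro k t ht
    rw [← hrk, ← Real.exp_add, ← Real.exp_add]
    have h1 : |β * (t - k * P)| ≤ |β| * P := by
      rw [abs_mul]
      refine mul_le_mul_of_nonneg_left (abs_le.2 ⟨?_, ?_⟩) (abs_nonneg _) <;>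
        linarith [ht.1, ht.2]
    have h2 := abs_le.1 h1
    constructor <;> apply Real.exp_le_exp.2 <;> linarith [h2.1, h2.2]
  have hAk : ∀ (k : ℕ) (t : ℝ), A (t + k * P) = A t := fun k t => hper.nat_mul k t
  have hkP : Tendsto (fun k : ℕ => (k : ℝ) * P) atTop atTop :=
    tendsto_natCast_atTop_atTop.atTop_mul_const hP
  have hgk : ∀ ε > 0, ∀ᶠ k : ℕ in atTop, 0 < (k : ℝ) * P ∧ ∀ θ,
      ∀ t ∈ Set.Icc ((k : ℝ) * P) (k * P + P), ‖x' θ t - A t (x θ t)‖ ≤ ε * r ^ k := by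
    intro ε hε
    obtain ⟨t₀, ht₀⟩ := eventually_atTop.1 (hg (ε / Real.exp (|β| * P)) (by positivity))
    filter_upwards [hkP.eventually_ge_atTop t₀, hkP.eventually_gt_atTop 0] with k hk hk0
    refine ⟨hk0, fun θ t ht => (ht₀ t (hk.trans ht.1) θ).trans ?_⟩
    rw [div_mul_eq_mul_div, div_le_iff₀ (Real.exp_pos _), mul_assoc, mul_comm (r ^ k)]
    exact mul_le_mul_of_nonneg_left (hloc k t ht).1 hε.le
  -- Sampling at multiples of the period turns the system into an approximate recurrence for the
  -- monodromy map at rate `r = e^{βP}`.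
  have hseq : ∀ ε > 0, ∀ᶠ k : ℕ in atTop, ∀ θ, ‖x θ (k * P)‖ ≤ ε * r ^ k := by
    refine eventually_norm_le_of_recurrence (M := M.toLinearMap) (C := C)
      (y := fun (k : ℕ) θ => x θ (k * P)) hr0 hroots ?_ ?_
    · filter_upwards [hkP.eventually_gt_atTop 0] with k hk θ
      rw [← hrk]
      exact hC θ _ hk
    · intro ε hε
      filter_upwards [hgk (ε / (|D| + 1)) (by positivity)] with k hk θ
      have h1 := hMD (fun τ => x θ (τ + k * P)) (fun τ => x' θ (τ + k * P))
        (ε / (|D| + 1) * r ^ k)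
        (fun τ hτ => ((hx θ (τ + k * P) (by linarith [hτ.1, hk.1])).comp_add_const
          τ (k * P)).hasDerivWithinAt)
        (fun τ hτ => by
          have := hk.2 θ (τ + k * P) ⟨by linarith [hτ.1], by linarith [hτ.2]⟩
          rwa [hAk] at this)
      have h2 : ((k + 1 : ℕ) : ℝ) * P = P + k * P := by push_cast; ring
      simp only [h2]
      simp only [zero_add] at h1
      refine h1.trans ?_
      have h3 : D * (ε / (|D| + 1)) ≤ ε := by
        rw [mul_div_assoc', div_le_iff₀ (by positivity)]
        nlinarith [le_abs_self D]
      rw [← mul_assoc]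
      exact mul_le_mul_of_nonneg_right h3 (by positivity)
  intro ε hε
  set G := gronwallBound 0 K 1 P with hG
  have hG0 : 0 ≤ G := gronwallBound_zero_nonneg hK0 hP.le
  -- Total loss in passing from the samples to all `t`: Grönwall growth of data and error over one
  -- period, times the cost of replacing `r ^ k` by `e^{βt}`.
  set B := Real.exp (|β| * P) * (Real.exp (K * P) + G) with hB
  have hB0 : 0 < B := by positivity
  have hη : 0 < ε / B := by positivity
  obtain ⟨k₀, hk₀⟩ := eventually_atTop.1 ((hseq _ hη).and (hgk _ hη))
  filter_upwards [eventually_ge_atTop ((k₀ : ℝ) * P), eventually_ge_atTop 0] with t ht ht0 θ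
  have hk : k₀ ≤ ⌊t / P⌋₊ := Nat.le_floor ((le_div_iff₀ hP).2 ht)
  set k := ⌊t / P⌋₊ with hkdef
  have htk : t ∈ Set.Icc ((k : ℝ) * P) (k * P + P) := by
    constructor
    · have := Nat.floor_le (div_nonneg ht0 hP.le)
      exact (le_div_iff₀ hP).1 this
    · have := (Nat.lt_floor_add_one (t / P)).le
      have := (div_le_iff₀ hP).1 this
      linarith
  obtain ⟨h1, hkpos, h2⟩ := hk₀ k hk
  have hgr := norm_le_gronwallBound_of_norm_deriv_right_le (f := x θ) (f' := x' θ)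
    (δ := ε / B * r ^ k) (K := K) (ε := ε / B * r ^ k) (a := k * P) (b := k * P + P)
    (fun s hs => (hx θ s (by linarith [hs.1])).continuousAt.continuousWithinAt)
    (fun s hs => (hx θ s (by linarith [hs.1])).hasDerivWithinAt)
    (h1 θ)
    (fun s hs => by
      have e1 := h2 θ s (Set.Ico_subset_Icc_self hs)
      have e2 : ‖x' θ s‖ ≤ ‖x' θ s - A s (x θ s)‖ + ‖A s (x θ s)‖ := by
        simpa using norm_add_le (x' θ s - A s (x θ s)) (A s (x θ s))
      have e3 := ((A s).le_opNorm (x θ s)).trans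
        (mul_le_mul_of_nonneg_right (hK s) (norm_nonneg _))
      linarith) t htk
  have hpos : 0 ≤ ε / B * r ^ k := by positivity
  have hmono := gronwallBound_mono hpos hpos hK0 (show t - k * P ≤ P by linarith [htk.2])
  rw [gronwallBound_eq_add _ _ _ P, ← hG] at hmono
  have hfin : ε / B * r ^ k * Real.exp (K * P) + ε / B * r ^ k * G ≤ ε * Real.exp (β * t) := by
    have e1 := mul_le_mul_of_nonneg_left (hloc k t htk).2
      (show 0 ≤ ε / B * (Real.exp (K * P) + G) by positivity)
    have e2 : ε / B * (Real.exp (K * P) + G) * (Real.exp (|β| * P) * Real.exp (β * t))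
        = ε * Real.exp (β * t) := by
      rw [hB]; field_simp
    rw [e2] at e1
    linarith
  exact hgr.trans (hmono.trans hfin)

/-- For all but finitely many weights `β`, approximate solutions of size `O(e^{β t})` of a
fourth order equation with periodic potential are `o(e^{β t})`. -/
theorem exists_finite_exceptional_weights (b : ℝ) {Q : ℝ → ℝ} (hQ : Continuous Q)
    {P : ℝ} (hP : 0 < P) (hper : Function.Periodic Q P) :
    ∃ S : Set ℝ, S.Finite ∧ ∀ β ∉ S, ∀ (Θ : Type) (U : ℕ → Θ → ℝ → ℝ) (C : ℝ),
      IsWeightedJet β C U →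
      (∀ ε > 0, ∀ᶠ t in atTop, ∀ θ, |U 4 θ t - b * U 2 θ t + Q t * U 0 θ t|
        ≤ ε * Real.exp (β * t)) →
      ∀ ε > 0, ∀ᶠ t in atTop, ∀ θ, |U 0 θ t| ≤ ε * Real.exp (β * t) := by
  -- Companion system for `(U 0, U 1, U 2, U 3)`, complexified so that the characteristic polynomial
  -- splits.
  let pr : Fin 4 → (Fin 4 → ℂ) →L[ℂ] ℂ := fun i => ContinuousLinearMap.proj i
  let A₀ : (Fin 4 → ℂ) →L[ℂ] (Fin 4 → ℂ) :=
    ContinuousLinearMap.pi ![pr 1, pr 2, pr 3, (b : ℂ) • pr 2]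
  let A₁ : (Fin 4 → ℂ) →L[ℂ] (Fin 4 → ℂ) := ContinuousLinearMap.pi ![0, 0, 0, pr 0]
  let A : ℝ → (Fin 4 → ℂ) →L[ℂ] (Fin 4 → ℂ) := fun t => A₀ - (Q t : ℂ) • A₁
  have hA : Continuous A := continuous_const.sub
    ((Complex.continuous_ofReal.comp hQ).smul continuous_const)
  have hAper : Function.Periodic A P := fun t => by simp only [A, hper t]
  obtain ⟨S, hS, h⟩ := exists_finite_exceptional_weights_system hA hP hAper
  refine ⟨S, hS, fun β hβ Θ U C hU hg ε hε => ?_⟩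
  have h1 := h β hβ Θ (fun θ t => ![(U 0 θ t : ℂ), (U 1 θ t : ℂ), (U 2 θ t : ℂ), (U 3 θ t : ℂ)])
    (fun θ t => ![(U 1 θ t : ℂ), (U 2 θ t : ℂ), (U 3 θ t : ℂ), (U 4 θ t : ℂ)]) C
    (fun θ t ht => by
      rw [hasDerivAt_pi]
      intro i
      fin_cases i
      · exact (hU.hasDerivAt 0 (by norm_num) θ t ht).ofReal_comp
      · exact (hU.hasDerivAt 1 (by norm_num) θ t ht).ofReal_comp
      · exact (hU.hasDerivAt 2 (by norm_num) θ t ht).ofReal_comp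
      · exact (hU.hasDerivAt 3 (by norm_num) θ t ht).ofReal_comp)
    (fun θ t ht => by
      have h0 := hU.bound 0 (by norm_num) θ t ht
      rw [pi_norm_le_iff_of_nonneg ((abs_nonneg _).trans h0)]
      intro i
      fin_cases i
      · simpa using h0
      · simpa using hU.bound 1 (by norm_num) θ t ht
      · simpa using hU.bound 2 (by norm_num) θ t ht
      · simpa using hU.bound 3 (by norm_num) θ t ht)
    (fun ε hε => by
      filter_upwards [hg ε hε] with t ht θ
      have hpos : 0 ≤ ε * Real.exp (β * t) := by positivity
      rw [pi_norm_le_iff_of_nonneg hpos]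
      intro i
      fin_cases i
      · simpa [A, A₀, A₁, pr] using hpos
      · simpa [A, A₀, A₁, pr] using hpos
      · simpa [A, A₀, A₁, pr] using hpos
      · have h2 := ht θ
        rw [← Real.norm_eq_abs, ← Complex.norm_real] at h2
        refine le_of_eq_of_le ?_ h2
        simp only [A, A₀, A₁, pr]
        congr 1
        simp
        ring)
    ε hε
  filter_upwards [h1] with t ht θ
  have := (norm_le_pi_norm _ (0 : Fin 4)).trans (ht θ)
  simpa using this

end EmdenFowler

namespace EmdenFowler

/-! ### Derivatives along chains -/

theorem iteratedDeriv_eq_of_hasDerivAt_chain {F : Type*} [NormedAddCommGroup F] [NormedSpace ℝ F]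
    {H : ℕ → ℝ → F} {N : ℕ} (hH : ∀ k < N, ∀ t, 0 < t → HasDerivAt (H k) (H (k + 1) t) t) :
    ∀ k ≤ N, ∀ t, 0 < t → iteratedDeriv k (H 0) t = H k t := by
  intro k
  induction k with
  | zero => intro _ t _; simp
  | succ k ih =>
    intro hk t ht
    rw [iteratedDeriv_succ]
    have : iteratedDeriv k (H 0) =ᶠ[𝓝 t] H k := by
      filter_upwards [lt_mem_nhds ht] with s hs
      exact ih (by omega) s hs
    rw [this.deriv_eq]
    exact (hH k (by omega) t ht).deriv

/-- The sequences obtained from `G` by iterating `∂ + β`, where `∂` is the shift. -/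
def twistedJet {F : Type*} [AddCommGroup F] [Module ℝ F] (β : ℝ) (G : ℕ → ℝ → F) :
    ℕ → ℕ → ℝ → F
  | 0, k, t => G k t
  | i + 1, k, t => β • twistedJet β G i k t + twistedJet β G i (k + 1) t

section Twist

variable {F : Type*} [NormedAddCommGroup F] [NormedSpace ℝ F] {G : ℕ → ℝ → F}

theorem hasDerivAt_twistedJet (β : ℝ)
    (hG : ∀ k < 4, ∀ t, 0 < t → HasDerivAt (G k) (G (k + 1) t) t) (i : ℕ) :
    ∀ k, i + k < 4 → ∀ t, 0 < t →
      HasDerivAt (twistedJet β G i k) (twistedJet β G i (k + 1) t) t := by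
  induction i with
  | zero => intro k hk t ht; exact hG k (by omega) t ht
  | succ i ih =>
    intro k hk t ht
    exact ((ih k (by omega) t ht).const_smul β).add (ih (k + 1) (by omega) t ht)

theorem norm_twistedJet_le (β : ℝ) {C : ℝ} (hG : ∀ k ≤ 4, ∀ t, 0 < t → ‖G k t‖ ≤ C) (i : ℕ) :
    ∀ k, i + k ≤ 4 → ∀ t, 0 < t → ‖twistedJet β G i k t‖ ≤ (|β| + 1) ^ i * C := by
  induction i with
  | zero => intro k hk t ht; simpa [twistedJet] using hG k (by omega) t ht
  | succ i ih =>
    intro k hk t ht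
    refine (norm_add_le _ _).trans ?_
    rw [norm_smul, Real.norm_eq_abs]
    have h1 := mul_le_mul_of_nonneg_left (ih k (by omega) t ht) (abs_nonneg β)
    have h2 := ih (k + 1) (by omega) t ht
    rw [pow_succ]
    linarith

/-- Conjugating `∂` by `e^{βt}` gives `∂ + β`, so these are the successive derivatives of `e^{βt} G
0`. -/
theorem hasDerivAt_exp_smul_twistedJet (β : ℝ)
    (hG : ∀ k < 4, ∀ t, 0 < t → HasDerivAt (G k) (G (k + 1) t) t) {i : ℕ} (hi : i < 4)
    {t : ℝ} (ht : 0 < t) :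
    HasDerivAt (fun s => Real.exp (β * s) • twistedJet β G i 0 s)
      (Real.exp (β * t) • twistedJet β G (i + 1) 0 t) t := by
  have h1 : HasDerivAt (fun s : ℝ => Real.exp (β * s)) (Real.exp (β * t) * β) t := by
    simpa using ((hasDerivAt_id t).const_mul β).exp
  refine (h1.smul (hasDerivAt_twistedJet β hG i 0 (by omega) t ht)).congr_deriv ?_
  simp only [twistedJet, smul_add, smul_smul]
  rw [add_comm]

end Twist

/-! ### Slices of maps on the cylinder -/

variable {n p : ℕ}

theorem radialExt_of_norm_eq_one (χ : EuclideanSpace ℝ (Fin n) → EuclideanSpace ℝ (Fin p))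
    {θ : EuclideanSpace ℝ (Fin n)} (hθ : ‖θ‖ = 1) : radialExt χ θ = χ θ := by
  simp [radialExt, hθ]

theorem IsHolder.exists_slice_jet {ζ : ℝ}
    {Φ : ℝ → EuclideanSpace ℝ (Fin n) → EuclideanSpace ℝ (Fin p)} (hΦ : IsHolder ζ Φ) :
    ∃ (G : ℕ → EuclideanSpace ℝ (Fin n) → ℝ → EuclideanSpace ℝ (Fin p)) (C : ℝ),
      ∀ θ : EuclideanSpace ℝ (Fin n), ‖θ‖ = 1 →
        (∀ t, G 0 θ t = Φ t θ) ∧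
        (∀ k < 4, ∀ t, 0 < t → HasDerivAt (G k θ) (G (k + 1) θ t) t) ∧
        ∀ k ≤ 4, ∀ t, 0 < t → ‖G k θ t‖ ≤ C := by
  obtain ⟨hcd, C, hC, -⟩ := hΦ
  set F : ℝ × EuclideanSpace ℝ (Fin n) → EuclideanSpace ℝ (Fin p) :=
    fun q => radialExt (Φ q.1) q.2 with hF
  -- Pure time derivatives: the Fréchet derivatives of `F` evaluated on copies of the unit vector
  -- `(1, 0)`. Their bounds are uniform in `θ`.
  refine ⟨fun k θ t => iteratedFDeriv ℝ k F (t, θ) (fun _ => (1, 0)), C, fun θ hθ => ⟨?_, ?_, ?_⟩⟩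
  · intro t
    simp [hF, radialExt_of_norm_eq_one _ hθ]
  · intro k hk t ht
    have hopen : IsOpen {q : ℝ × EuclideanSpace ℝ (Fin n) | 0 < q.1 ∧ q.2 ≠ 0} :=
      (isOpen_lt continuous_const continuous_fst).inter
        (isOpen_ne_fun continuous_snd continuous_const)
    have hmem : ((t, θ) : ℝ × EuclideanSpace ℝ (Fin n)) ∈
        {q : ℝ × EuclideanSpace ℝ (Fin n) | 0 < q.1 ∧ q.2 ≠ 0} :=
      ⟨ht, fun h => by simp [show θ = 0 from h] at hθ⟩
    have hat : ContDiffAt ℝ 4 F (t, θ) := hcd.contDiffAt (hopen.mem_nhds hmem)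
    have hdiff : DifferentiableAt ℝ (iteratedFDeriv ℝ k F) (t, θ) :=
      (hat.iteratedFDeriv_right (m := 1) (i := k)
        (by norm_cast; omega)).differentiableAt (by norm_num)
    have hcurve : HasDerivAt (fun s : ℝ => ((s, θ) : ℝ × EuclideanSpace ℝ (Fin n))) (1, 0) t :=
      (hasDerivAt_id t).prodMk (hasDerivAt_const t θ)
    have h1 := hdiff.hasFDerivAt.comp_hasDerivAt t hcurve
    have h2 := (ContinuousMultilinearMap.apply ℝ
      (fun _ : Fin k => ℝ × EuclideanSpace ℝ (Fin n)) (EuclideanSpace ℝ (Fin p))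
      (fun _ => (1, 0))).hasFDerivAt.comp_hasDerivAt t h1
    refine h2.congr_deriv ?_
    exact (iteratedFDeriv_succ_apply_left (𝕜 := ℝ) (f := F) (x := (t, θ)) (n := k)
      (fun _ => (1, 0))).symm
  · intro k hk t ht
    refine ((iteratedFDeriv ℝ k F (t, θ)).le_opNorm _).trans ?_
    have : ‖((1, 0) : ℝ × EuclideanSpace ℝ (Fin n))‖ = 1 := by simp [Prod.norm_def]
    simp only [this, Finset.prod_const_one, mul_one]
    exact hC k hk t ht θ hθ

theorem IsHolder.contDiffAt_radialExt {ζ : ℝ}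
    {Φ : ℝ → EuclideanSpace ℝ (Fin n) → EuclideanSpace ℝ (Fin p)} (hΦ : IsHolder ζ Φ)
    {t : ℝ} (ht : 0 < t) {x : EuclideanSpace ℝ (Fin n)} (hx : x ≠ 0) :
    ContDiffAt ℝ 4 (radialExt (Φ t)) x := by
  have hopen : IsOpen {q : ℝ × EuclideanSpace ℝ (Fin n) | 0 < q.1 ∧ q.2 ≠ 0} :=
    (isOpen_lt continuous_const continuous_fst).inter
      (isOpen_ne_fun continuous_snd continuous_const)
  have h1 := hΦ.1.contDiffAt (x := (t, x)) (hopen.mem_nhds ⟨ht, hx⟩)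
  exact h1.comp x (contDiffAt_const.prodMk contDiffAt_id)

theorem sphLaplacian_const_smul {χ : EuclideanSpace ℝ (Fin n) → EuclideanSpace ℝ (Fin p)}
    {θ : EuclideanSpace ℝ (Fin n)} (hχ : ContDiffAt ℝ 2 (radialExt χ) θ) (r : ℝ) :
    sphLaplacian (fun ω => r • χ ω) θ = r • sphLaplacian χ θ :=
  InnerProductSpace.laplacian_smul r hχ

/-- The extension along rays only samples the sphere. This is what allows the eigenvalue relation,
known only there, to be used inside `Δ_θ²`. -/
theorem sphLaplacian_congr {χ₁ χ₂ : EuclideanSpace ℝ (Fin n) → EuclideanSpace ℝ (Fin p)}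
    (h : ∀ ω, ‖ω‖ = 1 → χ₁ ω = χ₂ ω) {θ : EuclideanSpace ℝ (Fin n)} (hθ : ‖θ‖ = 1) :
    sphLaplacian χ₁ θ = sphLaplacian χ₂ θ := by
  have hne : θ ≠ 0 := fun h0 => by simp [h0] at hθ
  have : radialExt χ₁ =ᶠ[𝓝 θ] radialExt χ₂ := by
    filter_upwards [isOpen_ne.mem_nhds hne] with x hx
    apply h
    rw [norm_smul, norm_inv, norm_norm, inv_mul_cancel₀ (norm_ne_zero_iff.2 hx)]
  exact (InnerProductSpace.laplacian_congr_nhds this).eq_of_nhds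

/-- On maps with values in an eigenspace, the linearized operator acts as an ordinary differential
operator. -/
theorem linearized_exp_smul_of_inEigenspace {ζ β : ℝ} {j : ℕ}
    {Φ : ℝ → EuclideanSpace ℝ (Fin n) → EuclideanSpace ℝ (Fin p)} (hΦ : IsHolder ζ Φ)
    (hj : InEigenspace j Φ) (V : ℝ → EuclideanSpace ℝ (Fin p))
    {H : ℕ → ℝ → EuclideanSpace ℝ (Fin p)} {θ : EuclideanSpace ℝ (Fin n)} (hθ : ‖θ‖ = 1)
    (hH0 : ∀ t, H 0 t = Real.exp (β * t) • Φ t θ)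
    (hH : ∀ k < 4, ∀ t, 0 < t → HasDerivAt (H k) (H (k + 1) t) t) {t : ℝ} (ht : 0 < t) :
    linearized V (fun s ω => Real.exp (β * s) • Φ s ω) t θ
      = H 4 t - (K₂ n + 2 * sphEigenvalue n j) • H 2 t
        + (K₀ n + sphEigenvalue n j ^ 2 + J₀ n * sphEigenvalue n j) • H 0 t
        - fderiv ℝ (nonlinearity n p) (V t) (H 0 t) := by
  have hlap : ∀ s, 0 < s → ∀ ω : EuclideanSpace ℝ (Fin n), ‖ω‖ = 1 →
      sphLaplacian (fun ω => Real.exp (β * s) • Φ s ω) ω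
        = (-sphEigenvalue n j) • Real.exp (β * s) • Φ s ω := by
    intro s hs ω hω
    have hne : ω ≠ 0 := fun h0 => by simp [h0] at hω
    rw [sphLaplacian_const_smul ((hΦ.contDiffAt_radialExt hs hne).of_le (by norm_num)),
      hj s hs ω hω, smul_comm, neg_smul]
  have hlap2 : sphLaplacian (sphLaplacian (fun ω => Real.exp (β * t) • Φ t ω)) θ
      = sphEigenvalue n j ^ 2 • H 0 t := by
    rw [sphLaplacian_congr (hlap t ht) hθ]
    have hne : θ ≠ 0 := fun h0 => by simp [h0] at hθ
    have hcd : ContDiffAt ℝ 2 (radialExt (fun ω => Real.exp (β * t) • Φ t ω)) θ :=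
      ((hΦ.contDiffAt_radialExt ht hne).of_le (by norm_num)).const_smul _
    rw [sphLaplacian_const_smul hcd, hlap t ht θ hθ, hH0, smul_smul]
    congr 1; ring
  have hfun : (fun s => Real.exp (β * s) • Φ s θ) = H 0 := by
    funext s; rw [hH0]
  have hd := iteratedDeriv_eq_of_hasDerivAt_chain hH
  have hmix : iteratedDeriv 2
      (fun s => sphLaplacian (fun ω => Real.exp (β * s) • Φ s ω) θ) t
      = (-sphEigenvalue n j) • H 2 t := by
    have hev : (fun s => sphLaplacian (fun ω => Real.exp (β * s) • Φ s ω) θ)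
        =ᶠ[𝓝 t] fun s => (-sphEigenvalue n j) • H 0 s := by
      filter_upwards [lt_mem_nhds ht] with s hs
      rw [hlap s hs θ hθ, hH0]
    rw [hev.iteratedDeriv_eq 2]
    exact iteratedDeriv_eq_of_hasDerivAt_chain (N := 4)
      (H := fun k s => (-sphEigenvalue n j) • H k s)
      (fun k hk s hs => (hH k hk s hs).fun_const_smul _) 2 (by norm_num) t ht
  unfold linearized cylBilaplacian
  rw [hlap2, hmix, hlap t ht θ hθ, hfun, hd 4 (by norm_num) t ht, hd 2 (by norm_num) t ht,
    ← hH0 t]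
  beta_reduce
  rw [← hH0 t]
  module

/-- Scalar form of the equation satisfied by approximate kernel elements. -/
theorem IsApproxKernel.exists_jet {ζ β : ℝ} {j : ℕ} {V : ℝ → EuclideanSpace ℝ (Fin p)}
    {Φ : ℝ → EuclideanSpace ℝ (Fin n) → EuclideanSpace ℝ (Fin p)}
    (hΦ : IsApproxKernel ζ V j β Φ) (l : EuclideanSpace ℝ (Fin p) →L[ℝ] ℝ) {W : ℝ → ℝ}
    (hl : ∀ t w, l (fderiv ℝ (nonlinearity n p) (V t) w) = W t * l w) :
    ∃ (U : ℕ → sphere (0 : EuclideanSpace ℝ (Fin n)) 1 → ℝ → ℝ) (C : ℝ),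
      IsWeightedJet β C U ∧ (∀ θ t, U 0 θ t = Real.exp (β * t) * l (Φ t θ)) ∧
      ∀ ε > 0, ∀ᶠ t in atTop, ∀ θ, |U 4 θ t
        - (((j : ℝ) + n / 2) ^ 2 + ((j : ℝ) + γ n) ^ 2) * U 2 θ t
        + (((j : ℝ) + n / 2) ^ 2 * ((j : ℝ) + γ n) ^ 2 - W t) * U 0 θ t|
          ≤ ε * Real.exp (β * t) := by
  obtain ⟨hHol, hj, β', hβ', hlim⟩ := hΦ
  obtain ⟨G, C, hG⟩ := hHol.exists_slice_jet
  set H : ℕ → sphere (0 : EuclideanSpace ℝ (Fin n)) 1 → ℝ → EuclideanSpace ℝ (Fin p) :=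
    fun k θ t => Real.exp (β * t) • twistedJet β (fun k => G k θ) k 0 t with hHdef
  have hnorm : ∀ θ : sphere (0 : EuclideanSpace ℝ (Fin n)) 1,
      ‖(θ : EuclideanSpace ℝ (Fin n))‖ = 1 := fun θ => by simp
  have hH0 : ∀ θ t, H 0 θ t = Real.exp (β * t) • Φ t θ := by
    intro θ t
    simp only [hHdef, twistedJet, (hG θ (hnorm θ)).1 t]
  have hH : ∀ θ, ∀ k < 4, ∀ t, 0 < t → HasDerivAt (H k θ) (H (k + 1) θ t) t := fun θ k hk t ht =>
    hasDerivAt_exp_smul_twistedJet β (hG θ (hnorm θ)).2.1 hk ht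
  refine ⟨fun k θ t => l (H k θ t), ‖l‖ * ((|β| + 1) ^ 4 * |C|), ⟨?_, ?_⟩, ?_, ?_⟩
  · intro k hk θ t ht
    exact l.hasFDerivAt.comp_hasDerivAt t (hH θ k hk t ht)
  · intro k hk θ t ht
    rw [← Real.norm_eq_abs, mul_assoc]
    refine (l.le_opNorm _).trans (mul_le_mul_of_nonneg_left ?_ (norm_nonneg _))
    simp only [hHdef, norm_smul, Real.norm_eq_abs, Real.abs_exp]
    rw [mul_comm]
    refine mul_le_mul_of_nonneg_right ?_ (Real.exp_pos _).le
    refine (norm_twistedJet_le β (hG θ (hnorm θ)).2.2 k 0 (by omega) t ht).trans ?_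
    refine mul_le_mul (pow_le_pow_right₀ (by linarith [abs_nonneg β]) hk.le) (le_abs_self C) ?_
      (by positivity)
    exact (norm_nonneg _).trans ((hG θ (hnorm θ)).2.2 0 (by norm_num) t ht)
  · intro θ t
    simp only [hH0, map_smul, smul_eq_mul]
  · intro ε hε
    rw [Metric.tendstoUniformlyOn_iff] at hlim
    filter_upwards [hlim (ε / (‖l‖ + 1)) (by positivity), eventually_gt_atTop 0] with t ht ht0 θ
    have h1 := ht θ θ.2
    rw [dist_zero_left, norm_smul, Real.norm_eq_abs, Real.abs_exp, Real.exp_neg,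
      inv_mul_lt_iff₀ (Real.exp_pos _)] at h1
    -- Here `β' < β` enters: decay relative to `e^{β't}` implies decay relative to `e^{βt}`.
    have h2 : Real.exp (β' * t) ≤ Real.exp (β * t) :=
      Real.exp_le_exp.2 (mul_le_mul_of_nonneg_right hβ'.le ht0.le)
    have h3 := linearized_exp_smul_of_inEigenspace hHol hj V (hnorm θ) (hH0 θ) (hH θ) ht0
    have h4 : l (linearized V (fun s ω => Real.exp (β * s) • Φ s ω) t θ)
        = l (H 4 θ t) - (((j : ℝ) + n / 2) ^ 2 + ((j : ℝ) + γ n) ^ 2) * l (H 2 θ t)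
        + (((j : ℝ) + n / 2) ^ 2 * ((j : ℝ) + γ n) ^ 2 - W t) * l (H 0 θ t) := by
      rw [h3]
      simp only [map_sub, map_add, map_smul, smul_eq_mul, hl]
      -- Together with `e2`, this factors the characteristic polynomial on the `j`-th eigenspace,
      -- with roots `±(j + n/2)` and `±(j + γ)`.
      have e1 : K₂ n + 2 * sphEigenvalue n j = ((j : ℝ) + n / 2) ^ 2 + ((j : ℝ) + γ n) ^ 2 := by
        simp only [K₂, sphEigenvalue, γ]; ring
      have e2 : K₀ n + sphEigenvalue n j ^ 2 + J₀ n * sphEigenvalue n j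
          = ((j : ℝ) + n / 2) ^ 2 * ((j : ℝ) + γ n) ^ 2 := by
        simp only [K₀, J₀, sphEigenvalue, γ]; ring
      rw [e1, e2]
      ring
    rw [← h4, ← Real.norm_eq_abs]
    refine (l.le_opNorm _).trans ?_
    calc ‖l‖ * ‖linearized V (fun s ω => Real.exp (β * s) • Φ s ω) t θ‖
        ≤ (‖l‖ + 1) * (Real.exp (β * t) * (ε / (‖l‖ + 1))) := by
          refine mul_le_mul (by linarith) (h1.le.trans ?_) (norm_nonneg _) (by positivity)
          exact mul_le_mul_of_nonneg_right h2 (by positivity)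
      _ = ε * Real.exp (β * t) := by field_simp

/-! ### The derivative of the nonlinearity -/

/-- The norm power is differentiated as `(‖V‖²)^(r/2)`, which is smooth away from `0`. The rank-one
term is the radial part and vanishes on `Λ^⊥`. -/
theorem fderiv_nonlinearity_smul {Λ : EuclideanSpace ℝ (Fin p)} (hΛ : ‖Λ‖ = 1) {s : ℝ}
    (hs : 0 < s) (w : EuclideanSpace ℝ (Fin p)) :
    fderiv ℝ (nonlinearity n p) (s • Λ) w = (c n * s ^ (critExp n - 2)) • w
      + ((critExp n - 2) * (c n * s ^ (critExp n - 2)) * inner ℝ Λ w) • Λ := by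
  set r := critExp n - 2 with hr
  have hnorm : ‖s • Λ‖ = s := by rw [norm_smul, hΛ, mul_one, Real.norm_eq_abs, abs_of_pos hs]
  have h1 : HasFDerivAt (fun V : EuclideanSpace ℝ (Fin p) => ‖V‖ ^ 2)
      (2 • innerSL ℝ (s • Λ)) (s • Λ) := (hasStrictFDerivAt_norm_sq (s • Λ)).hasFDerivAt
  have h2 := h1.rpow_const (p := r / 2) (Or.inl (by rw [hnorm]; positivity))
  have hfun : nonlinearity n p = fun V => (c n * (‖V‖ ^ 2) ^ (r / 2)) • V := by
    funext V
    simp only [nonlinearity, ← hr]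
    rw [← Real.rpow_natCast, ← Real.rpow_mul (norm_nonneg _)]
    congr 3
    push_cast; ring
  have h3 := (h2.const_mul (c n)).smul (hasFDerivAt_id (s • Λ))
  rw [hfun]
  have h4 := h3.fderiv
  have h5 := congrArg (fun B => B w) h4
  refine h5.trans ?_
  have e1 : (s ^ 2) ^ (r / 2) = s ^ r := by
    rw [← Real.rpow_natCast, ← Real.rpow_mul hs.le]; congr 1; push_cast; ring
  have e2 : (s ^ 2) ^ (r / 2 - 1) * s * s = s ^ r := by
    rw [Real.rpow_sub_one (by positivity), e1]; field_simp
  simp only [hnorm, e1, add_apply, smul_apply,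
    ContinuousLinearMap.smulRight_apply, ContinuousLinearMap.id_apply, id, innerSL_apply_apply,
    inner_smul_left, smul_eq_mul, nsmul_eq_mul, RCLike.conj_to_real, smul_smul]
  rw [← e2]
  congr 2
  push_cast; ring

end EmdenFowler

namespace EmdenFowler

/-! ### Weights that are not indicial roots -/

/-- Approximate solutions of size `O(e^{β t})` of the equation with characteristic roots `±A`, `±B`
and potential `W` are `o(e^{β t})`. -/
def IsRegularWeight (W : ℝ → ℝ) (A B β : ℝ) : Prop :=
  ∀ (Θ : Type) (U : ℕ → Θ → ℝ → ℝ) (C : ℝ), IsWeightedJet β C U →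
    (∀ ε > 0, ∀ᶠ t in atTop, ∀ θ, |U 4 θ t - (A ^ 2 + B ^ 2) * U 2 θ t
      + (A ^ 2 * B ^ 2 - W t) * U 0 θ t| ≤ ε * Real.exp (β * t)) →
    ∀ ε > 0, ∀ᶠ t in atTop, ∀ θ, |U 0 θ t| ≤ ε * Real.exp (β * t)

theorem IsApproxKernel.eventually_abs_le {n p : ℕ} {ζ β : ℝ} {j : ℕ}
    {V : ℝ → EuclideanSpace ℝ (Fin p)}
    {Φ : ℝ → EuclideanSpace ℝ (Fin n) → EuclideanSpace ℝ (Fin p)}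
    (hΦ : IsApproxKernel ζ V j β Φ) (l : EuclideanSpace ℝ (Fin p) →L[ℝ] ℝ) {W : ℝ → ℝ}
    (hl : ∀ t w, l (fderiv ℝ (nonlinearity n p) (V t) w) = W t * l w)
    (hW : IsRegularWeight W ((j : ℝ) + n / 2) ((j : ℝ) + γ n) β) {ε : ℝ} (hε : 0 < ε) :
    ∀ᶠ t in atTop, ∀ θ : EuclideanSpace ℝ (Fin n), ‖θ‖ = 1 → |l (Φ t θ)| ≤ ε := by
  obtain ⟨U, C, hU, hU0, hg⟩ := hΦ.exists_jet l hl
  filter_upwards [hW _ U C hU hg ε hε] with t ht θ hθ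
  have h1 := ht ⟨θ, by simpa using hθ⟩
  rw [hU0, abs_mul, Real.abs_exp, mul_comm] at h1
  exact le_of_mul_le_mul_right h1 (Real.exp_pos _)

/-- The functionals `⟨Λ, ·⟩` and `x ↦ x i - Λ i ⟨Λ, x⟩` diagonalize the derivative of the
nonlinearity, with the two potentials as eigenvalues, and together recover every coordinate. If all
of them tend to `0` uniformly on the sphere, so does `Φ`. -/
theorem notMem_indicialRoots {n p : ℕ} {ζ β T : ℝ} {v : ℝ → ℝ} (hv : ∀ t, 0 < v t)
    {Λ : EuclideanSpace ℝ (Fin p)} (hΛ : ‖Λ‖ = 1)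
    (h₁ : ∀ j : ℕ, IsRegularWeight (fun t => 1 * (c n * v (t + T) ^ (critExp n - 2)))
      ((j : ℝ) + n / 2) ((j : ℝ) + γ n) β)
    (h₂ : ∀ j : ℕ, IsRegularWeight
      (fun t => (critExp n - 1) * (c n * v (t + T) ^ (critExp n - 2)))
      ((j : ℝ) + n / 2) ((j : ℝ) + γ n) β) :
    β ∉ indicialRoots n ζ (fowlerMap v T Λ) := by
  rintro ⟨j, Φ, hΦ, δ, hδ, hfreq⟩
  have hinner : inner ℝ Λ Λ = (1 : ℝ) := by rw [real_inner_self_eq_norm_sq, hΛ, one_pow]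
  let l : Fin p → EuclideanSpace ℝ (Fin p) →L[ℝ] ℝ := fun i =>
    (EuclideanSpace.proj i : EuclideanSpace ℝ (Fin p) →L[ℝ] ℝ) - Λ i • innerSL ℝ Λ
  -- Each coordinate will be at most `2η`, so `‖x‖ ≤ 2pη < δ`.
  set η := δ / (2 * (2 * ((p : ℝ) + 1))) with hη
  have hη0 : 0 < η := by positivity
  have e₀ := hΦ.eventually_abs_le (innerSL ℝ Λ) (W := _) (fun t w => by
    rw [fowlerMap, fderiv_nonlinearity_smul hΛ (hv _)]
    simp only [map_add, map_smul, innerSL_apply_apply, hinner, smul_eq_mul, mul_one]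
    ring) (h₂ j) hη0
  have e₁ : ∀ i, ∀ᶠ t in atTop, ∀ θ : EuclideanSpace ℝ (Fin n), ‖θ‖ = 1 →
      |l i (Φ t θ)| ≤ η := fun i => hΦ.eventually_abs_le (l i) (W := _) (fun t w => by
    rw [fowlerMap, fderiv_nonlinearity_smul hΛ (hv _)]
    simp [l, hΛ, inner_add_right, inner_smul_right]
    ring) (h₁ j) hη0
  have hall := (eventually_all.2 e₁).and e₀
  obtain ⟨t, ⟨θ, hθ, hle⟩, ht₁, ht₀⟩ := (hfreq.and_eventually hall).exists
  set x := Φ t θ with hx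
  have hcoord : ∀ i, |x i| ≤ 2 * η := by
    intro i
    have h1 := ht₁ i θ hθ
    have h0 := ht₀ θ hθ
    have hΛi : |Λ i| ≤ 1 := by
      have := PiLp.norm_apply_le Λ i
      rwa [hΛ, Real.norm_eq_abs] at this
    have h2 : x i = l i x + Λ i * innerSL ℝ Λ x := by simp [l]
    rw [h2]
    refine (abs_add_le _ _).trans ?_
    rw [abs_mul]
    have h3 : |Λ i| * |innerSL ℝ Λ x| ≤ 1 * η := mul_le_mul hΛi h0 (abs_nonneg _) zero_le_one
    linarith
  have hsum : ‖x‖ ≤ ∑ i, |x i| := by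
    conv_lhs => rw [← (EuclideanSpace.basisFun (Fin p) ℝ).sum_repr x]
    refine (norm_sum_le _ _).trans (Finset.sum_le_sum fun i _ => ?_)
    simp [norm_smul]
  have hsum2 : ∑ i, |x i| ≤ p * (2 * η) := by
    simpa using Finset.sum_le_sum fun i (_ : i ∈ Finset.univ) => hcoord i
  have hfin : p * (2 * η) < δ := by
    rw [hη]
    have : (p : ℝ) * (2 * (δ / (2 * (2 * (p + 1))))) = δ * (p / (2 * (p + 1))) := by
      field_simp
    rw [this]
    have h1 : (p : ℝ) / (2 * (p + 1)) < 1 := by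
      rw [div_lt_one (by positivity)]
      have : (0 : ℝ) ≤ p := by positivity
      linarith
    nlinarith
  linarith

theorem half_le_γ {n : ℕ} (hn : 5 ≤ n) : 1 / 2 ≤ γ n := by
  have : (5 : ℝ) ≤ n := by exact_mod_cast hn
  unfold γ; linarith

theorem critExp_sub_two_pos {n : ℕ} (hn : 5 ≤ n) : 0 < critExp n - 2 := by
  have h : (5 : ℝ) ≤ n := by exact_mod_cast hn
  have h4 : (0 : ℝ) < n - 4 := by linarith
  have : critExp n - 2 = 8 / ((n : ℝ) - 4) := by
    unfold critExp; field_simp; ring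
  rw [this]; positivity

/-- For `n ≥ 5` all characteristic roots have modulus at least `j + 1/2`, so weights with `|β| <
1/2` avoid them, with a gap that grows with `j`. -/
theorem sq_le_sq_sub_sq {x y j β : ℝ} (hj : 0 ≤ j) (hx : j + y ≤ x) (hy : 1 / 2 ≤ y)
    (hβ : |β| < 1 / 2) : j ^ 2 ≤ x ^ 2 - β ^ 2 ∧ 0 < x ^ 2 - β ^ 2 := by
  have h1 : β ^ 2 < (1 / 2) ^ 2 := by rw [← sq_abs β]; gcongr
  have h2 : (j + 1 / 2) ^ 2 ≤ x ^ 2 := by gcongr; linarith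
  constructor <;> nlinarith

theorem isRegularWeight_of_tendsto_zero {n : ℕ} (hn : 5 ≤ n) {W : ℝ → ℝ}
    (hW : Tendsto W atTop (𝓝 0)) {β : ℝ} (hβ : |β| < 1 / 2) (j : ℕ) :
    IsRegularWeight W ((j : ℝ) + n / 2) ((j : ℝ) + γ n) β := by
  intro Θ U C hU hg
  have hn5 : (5 : ℝ) ≤ n := by exact_mod_cast hn
  have hA := (sq_le_sq_sub_sq (Nat.cast_nonneg j) (le_refl ((j : ℝ) + n / 2)) (by linarith) hβ).2
  have hB := (sq_le_sq_sub_sq (Nat.cast_nonneg j) (le_refl ((j : ℝ) + γ n)) (half_le_γ hn) hβ).2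
  set Q := |((j : ℝ) + n / 2) ^ 2 - β ^ 2| * |((j : ℝ) + γ n) ^ 2 - β ^ 2| with hQ
  have hQ0 : 0 < Q := mul_pos (abs_pos.2 hA.ne') (abs_pos.2 hB.ne')
  refine hU.eventually_abs_le_of_potential_small (w := Q / 32) (by linarith) (by linarith)
    (by linarith) (by positivity) ?_ hg
  have := (tendsto_zero_iff_abs_tendsto_zero W).1 hW
  filter_upwards [this.eventually (gt_mem_nhds (show 0 < Q / 32 by positivity))] with t ht
  exact ht.le

/-- High modes are handled by the growing spectral gap, simultaneously for all `|β| < 1/2`; only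
finitely many modes are left to Floquet theory. -/
theorem exists_isRegularWeight_of_periodic {n : ℕ} (hn : 5 ≤ n) {W : ℝ → ℝ} (hW : Continuous W)
    {P : ℝ} (hP : 0 < P) (hper : Function.Periodic W P) :
    ∃ ε > 0, ∀ β, |β| < ε → β ≠ 0 → ∀ j : ℕ,
      IsRegularWeight W ((j : ℝ) + n / 2) ((j : ℝ) + γ n) β := by
  have hn5 : (5 : ℝ) ≤ n := by exact_mod_cast hn
  obtain ⟨w, hw0, hw⟩ := exists_norm_le_of_periodic hW hP hper
  obtain ⟨J, hJ⟩ := exists_nat_gt (32 * w)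
  have hfin : ∀ j : ℕ, ∃ S : Set ℝ, S.Finite ∧ ∀ β ∉ S,
      IsRegularWeight W ((j : ℝ) + n / 2) ((j : ℝ) + γ n) β := by
    intro j
    obtain ⟨S, hS, h⟩ := exists_finite_exceptional_weights
      (((j : ℝ) + n / 2) ^ 2 + ((j : ℝ) + γ n) ^ 2)
      (Q := fun t => ((j : ℝ) + n / 2) ^ 2 * ((j : ℝ) + γ n) ^ 2 - W t)
      (continuous_const.sub hW) hP (fun t => by simp only [hper t])
    exact ⟨S, hS, h⟩
  choose S hS hreg using hfin
  -- A finite set without `0` stays at positive distance from `0`.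
  have hSfin : ((⋃ j ∈ Finset.range (J + 1), S j) \ {0}).Finite :=
    ((Finset.range (J + 1)).finite_toSet.biUnion fun j _ => hS j).subset Set.sdiff_subset
  obtain ⟨ε, hε, hball⟩ := Metric.mem_nhds_iff.1
    (hSfin.isClosed.isOpen_compl.mem_nhds (show (0 : ℝ) ∈ _ by simp))
  refine ⟨min ε (1 / 2), by positivity, fun β hβ hβ0 j => ?_⟩
  by_cases hj : j < J + 1
  · refine hreg j β fun hmem => ?_
    have h1 : β ∈ ball (0 : ℝ) ε := by
      rw [mem_ball_zero_iff, Real.norm_eq_abs]; exact hβ.trans_le (min_le_left _ _)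
    exact hball h1 ⟨Set.mem_biUnion (Finset.mem_coe.2 (Finset.mem_range.2 hj)) hmem, hβ0⟩
  · have hβ2 : |β| < 1 / 2 := hβ.trans_le (min_le_right _ _)
    have hjJ : (J : ℝ) + 1 ≤ j := by exact_mod_cast not_lt.1 hj
    obtain ⟨hA, hA0⟩ := sq_le_sq_sub_sq (Nat.cast_nonneg j) (le_refl ((j : ℝ) + n / 2))
      (by linarith) hβ2
    obtain ⟨hB, hB0⟩ := sq_le_sq_sub_sq (Nat.cast_nonneg j) (le_refl ((j : ℝ) + γ n))
      (half_le_γ hn) hβ2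
    intro Θ U C hU hg
    refine hU.eventually_abs_le_of_potential_small (w := w) (by linarith) (by linarith) ?_ hw0
      (Eventually.of_forall hw) hg
    rw [abs_of_pos hA0, abs_of_pos hB0]
    have hJ0 : (0 : ℝ) ≤ J := Nat.cast_nonneg J
    have h1 : (j : ℝ) ≤ (j : ℝ) ^ 2 := by nlinarith
    have h2 : (1 : ℝ) ≤ (j : ℝ) ^ 2 := by nlinarith
    calc 32 * w ≤ j * 1 := by linarith
      _ ≤ _ := mul_le_mul (h1.trans hA) (h2.trans hB) zero_le_one hA0.le

theorem exists_isolating_of_periodic {n p : ℕ} (hn : 5 ≤ n) (ζ : ℝ) {v : ℝ → ℝ}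
    (hcont : Continuous v) (hv : ∀ t, 0 < v t) {P : ℝ} (hP : 0 < P)
    (hper : Function.Periodic v P) (T : ℝ) {Λ : EuclideanSpace ℝ (Fin p)} (hΛ : ‖Λ‖ = 1) :
    ∃ ε : ℝ, 0 < ε ∧ ∀ β ∈ indicialRoots n ζ (fowlerMap v T Λ), |β| < ε → β = 0 := by
  have hWc : ∀ κ : ℝ, Continuous fun t => κ * (c n * v (t + T) ^ (critExp n - 2)) := fun κ =>
    continuous_const.mul (continuous_const.mul
      ((hcont.comp (continuous_add_const T)).rpow_const fun t => Or.inl (hv _).ne'))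
  have hWp : ∀ κ : ℝ, Function.Periodic (fun t => κ * (c n * v (t + T) ^ (critExp n - 2))) P :=
    fun κ t => by
      have : v (t + P + T) = v (t + T) := by rw [add_right_comm]; exact hper _
      simp only [this]
  obtain ⟨ε₁, hε₁, h₁⟩ := exists_isRegularWeight_of_periodic hn (hWc 1) hP (hWp 1)
  obtain ⟨ε₂, hε₂, h₂⟩ := exists_isRegularWeight_of_periodic hn (hWc (critExp n - 1)) hP
    (hWp (critExp n - 1))
  refine ⟨min ε₁ ε₂, lt_min hε₁ hε₂, fun β hβ hlt => ?_⟩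
  by_contra h0
  exact notMem_indicialRoots hv hΛ (h₁ β (hlt.trans_le (min_le_left _ _)) h0)
    (h₂ β (hlt.trans_le (min_le_right _ _)) h0) hβ

/-- The potential decays, so every mode is a small perturbation for large `t`. In fact no indicial
root, not even `0`, lies in `(-1/2, 1/2)`. -/
theorem exists_isolating_of_cosh {n p : ℕ} (hn : 5 ≤ n) (ζ : ℝ) {v : ℝ → ℝ}
    (hv : ∀ t, v t = Real.cosh t ^ (-γ n)) (T : ℝ) {Λ : EuclideanSpace ℝ (Fin p)}
    (hΛ : ‖Λ‖ = 1) :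
    ∃ ε : ℝ, 0 < ε ∧ ∀ β ∈ indicialRoots n ζ (fowlerMap v T Λ), |β| < ε → β = 0 := by
  have hpos : ∀ t, 0 < v t := fun t => by rw [hv]; exact Real.rpow_pos_of_pos (Real.cosh_pos t) _
  have hcosh : Tendsto (fun t => Real.cosh (t + T)) atTop atTop := by
    refine tendsto_atTop_mono (fun t => ?_)
      ((Real.tendsto_exp_atTop.comp (tendsto_atTop_add_const_right _ T tendsto_id)).atTop_div_const
        (show (0 : ℝ) < 2 by norm_num))
    rw [Real.cosh_eq]
    have := Real.exp_pos (-(t + T))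
    simp only [Function.comp, id]
    linarith
  have hv0 : Tendsto (fun t => v (t + T)) atTop (𝓝 0) := by
    simp only [hv]
    exact (tendsto_rpow_neg_atTop (by linarith [half_le_γ hn])).comp hcosh
  have hW : ∀ κ : ℝ, Tendsto (fun t => κ * (c n * v (t + T) ^ (critExp n - 2))) atTop (𝓝 0) := by
    intro κ
    have h1 := hv0.rpow_const (p := critExp n - 2) (Or.inr (critExp_sub_two_pos hn).le)
    rw [Real.zero_rpow (critExp_sub_two_pos hn).ne'] at h1
    simpa using (h1.const_mul (c n)).const_mul κ
  refine ⟨1 / 2, by norm_num, fun β hβ hlt => ?_⟩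
  exact absurd hβ (notMem_indicialRoots hpos hΛ
    (fun j => isRegularWeight_of_tendsto_zero hn (hW 1) hlt j)
    (fun j => isRegularWeight_of_tendsto_zero hn (hW (critExp n - 1)) hlt j))

end EmdenFowler

namespace EmdenFowler

/-! ### Kernel elements for the weight zero -/

theorem contDiff_add_of_iteratedDeriv (m : ℕ) (k : ℕ) :
    ∀ {f : ℝ → ℝ}, ContDiff ℝ k f → ContDiff ℝ m (iteratedDeriv k f) →
      ContDiff ℝ ((m + k : ℕ) : WithTop ℕ∞) f := by
  induction k with
  | zero => intro f _ h; simpa using h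
  | succ k ih =>
    intro f hf h
    have hf' : ContDiff ℝ ((k : WithTop ℕ∞) + 1) f := by exact_mod_cast hf
    rw [contDiff_succ_iff_deriv] at hf'
    have h1 := ih hf'.2.2 (by rwa [← iteratedDeriv_succ'])
    have : ((m + (k + 1) : ℕ) : WithTop ℕ∞) = ((m + k : ℕ) : WithTop ℕ∞) + 1 := by
      push_cast; ring
    rw [this, contDiff_succ_iff_deriv]
    exact ⟨hf'.1, fun h => absurd h (by exact_mod_cast WithTop.natCast_ne_top _), h1⟩

theorem periodic_iteratedDeriv {F : Type*} [NormedAddCommGroup F] [NormedSpace ℝ F] {f : ℝ → F}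
    {P : ℝ} (hf : Function.Periodic f P) (k : ℕ) : Function.Periodic (iteratedDeriv k f) P := by
  intro t
  have h1 : (fun z => f (z + P)) = f := funext hf
  have h2 := congrFun (iteratedDeriv_comp_add_const k f P) t
  rw [h1] at h2
  exact h2.symm

variable {n p : ℕ}

/-- A bounded fifth derivative makes the fourth Lipschitz, which gives the Hölder bound at distances
up to `1`; at larger distances boundedness of the fourth derivative is enough. -/
theorem isHolder_of_periodic {ζ : ℝ} (hζ : ζ ∈ Set.Ioo (0 : ℝ) 1)
    {f : ℝ → EuclideanSpace ℝ (Fin p)} (hf : ContDiff ℝ 5 f) {P : ℝ} (hP : 0 < P)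
    (hper : Function.Periodic f P) :
    IsHolder ζ (fun t (_ : EuclideanSpace ℝ (Fin n)) => f t) := by
  set F : ℝ × EuclideanSpace ℝ (Fin n) → EuclideanSpace ℝ (Fin p) := fun q => f q.1 with hF
  have hFcd : ContDiff ℝ 5 F := hf.comp contDiff_fst
  have hbd : ∀ k : ℕ, k ≤ 5 → ∃ K, 0 ≤ K ∧ ∀ q, ‖iteratedFDeriv ℝ k F q‖ ≤ K := by
    intro k hk
    obtain ⟨K, hK0, hK⟩ := exists_norm_le_of_periodic
      (hf.continuous_iteratedDeriv k (by exact_mod_cast hk)) hP (periodic_iteratedDeriv hper k)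
    refine ⟨K, hK0, fun q => ?_⟩
    have h1 := (ContinuousLinearMap.fst ℝ ℝ (EuclideanSpace ℝ (Fin n))).iteratedFDeriv_comp_right
      hf q (i := k) (by exact_mod_cast hk)
    have h2 : F = f ∘ ContinuousLinearMap.fst ℝ ℝ (EuclideanSpace ℝ (Fin n)) := rfl
    rw [h2, h1]
    refine (ContinuousMultilinearMap.norm_compContinuousLinearMap_le _ _).trans ?_
    rw [norm_iteratedFDeriv_eq_norm_iteratedDeriv]
    have h3 : ∏ _i : Fin k, ‖ContinuousLinearMap.fst ℝ ℝ (EuclideanSpace ℝ (Fin n))‖ ≤ 1 :=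
      Finset.prod_le_one (fun _ _ => norm_nonneg _)
        (fun _ _ => ContinuousLinearMap.norm_fst_le ℝ ℝ (EuclideanSpace ℝ (Fin n)))
    have h4 := mul_le_mul (hK q.1) h3 (Finset.prod_nonneg fun _ _ => norm_nonneg _) hK0
    simpa using h4
  choose! K hK0 hK using hbd
  set D := ∑ k ∈ Finset.range 6, K k with hD
  have hKD : ∀ k ≤ 5, K k ≤ D := fun k hk =>
    Finset.single_le_sum (f := K) (fun i hi => hK0 i (by have := Finset.mem_range.1 hi; omega))
      (Finset.mem_range.2 (by omega))
  have hD0 : 0 ≤ D := (hK0 0 (by norm_num)).trans (hKD 0 (by norm_num))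
  refine ⟨(hFcd.of_le (by norm_num)).contDiffOn, 2 * D, ?_, ?_⟩
  · intro k hk t _ θ _
    exact ((hK k (by omega) (t, θ)).trans (hKD k (by omega))).trans (by linarith)
  · intro s t _ _ ω θ _ _
    change ‖iteratedFDeriv ℝ 4 F (s, ω) - iteratedFDeriv ℝ 4 F (t, θ)‖ ≤ _
    have hd0 : 0 ≤ dist (s, ω) (t, θ) := dist_nonneg
    rcases le_total (dist (s, ω) (t, θ)) 1 with h1 | h1
    · have hdiff : Differentiable ℝ (iteratedFDeriv ℝ 4 F) :=
        hFcd.differentiable_iteratedFDeriv (by norm_num)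
      have h2 := convex_univ.norm_image_sub_le_of_norm_fderiv_le (𝕜 := ℝ)
        (f := iteratedFDeriv ℝ 4 F) (C := D) (fun q _ => hdiff q)
        (fun q _ => by
          rw [norm_fderiv_iteratedFDeriv]
          exact (hK 5 le_rfl q).trans (hKD 5 le_rfl))
        (Set.mem_univ (t, θ)) (Set.mem_univ (s, ω))
      rw [← dist_eq_norm (s, ω)] at h2
      have h3 : dist (s, ω) (t, θ) ≤ dist (s, ω) (t, θ) ^ ζ := by
        rcases hd0.eq_or_lt with h0 | h0
        · rw [← h0]; exact Real.zero_rpow_nonneg ζ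
        · simpa using Real.rpow_le_rpow_of_exponent_ge h0 h1 hζ.2.le
      have h4 := mul_le_mul_of_nonneg_left h3 hD0
      have h5 : 0 ≤ D * dist (s, ω) (t, θ) ^ ζ := mul_nonneg hD0 (Real.rpow_nonneg hd0 _)
      linarith
    · have h2 := norm_sub_le (iteratedFDeriv ℝ 4 F (s, ω)) (iteratedFDeriv ℝ 4 F (t, θ))
      have h3 := (hK 4 (by norm_num) (s, ω)).trans (hKD 4 (by norm_num))
      have h4 := (hK 4 (by norm_num) (t, θ)).trans (hKD 4 (by norm_num))
      have h5 : 1 ≤ dist (s, ω) (t, θ) ^ ζ := Real.one_le_rpow h1 hζ.1.le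
      nlinarith

/-- A periodic solution of the scalar equation gives a kernel element which is independent of the
spherical variable. -/
theorem isApproxKernel_of_periodic {ζ : ℝ} (hζ : ζ ∈ Set.Ioo (0 : ℝ) 1) {g : ℝ → ℝ}
    (hg : ContDiff ℝ 5 g) {P : ℝ} (hP : 0 < P) (hper : Function.Periodic g P)
    {e : EuclideanSpace ℝ (Fin p)} {V : ℝ → EuclideanSpace ℝ (Fin p)} {W : ℝ → ℝ}
    (hV : ∀ t, fderiv ℝ (nonlinearity n p) (V t) e = W t • e)
    (hode : ∀ t, iteratedDeriv 4 g t - K₂ n * iteratedDeriv 2 g t + K₀ n * g t = W t * g t) :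
    IsApproxKernel ζ V 0 0 (fun t (_ : EuclideanSpace ℝ (Fin n)) => g t • e) := by
  have hHol : IsHolder ζ (fun t (_ : EuclideanSpace ℝ (Fin n)) => g t • e) :=
    isHolder_of_periodic hζ (hg.smul contDiff_const) hP (fun t => by simp only [hper t])
  have hE : InEigenspace 0 (fun t (_ : EuclideanSpace ℝ (Fin n)) => g t • e) := by
    intro t _ θ _
    have : radialExt (fun _ : EuclideanSpace ℝ (Fin n) => g t • e) = fun _ => g t • e := rfl
    simp [sphLaplacian, this, sphEigenvalue]
  -- The equation holds exactly, so any negative `β'` would do.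
  refine ⟨hHol, hE, -1, by norm_num, ?_⟩
  rw [Metric.tendstoUniformlyOn_iff]
  intro ε hε
  filter_upwards [eventually_gt_atTop 0] with t ht θ hθ
  have hlin := linearized_exp_smul_of_inEigenspace (β := 0) hHol hE V
    (H := fun k s => iteratedDeriv k g s • e) (θ := θ) (by simpa using hθ) (by simp)
    (fun k hk s _ => by
      have h1 : DifferentiableAt ℝ (iteratedDeriv k g) s :=
        (hg.differentiable_iteratedDeriv k (by norm_cast; omega)) s
      rw [iteratedDeriv_succ]
      exact h1.hasDerivAt.smul_const e) ht
  have hzero : linearized V (fun s (_ : EuclideanSpace ℝ (Fin n)) =>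
      Real.exp (0 * s) • g s • e) t θ = 0 := by
    rw [hlin, map_smul, hV, iteratedDeriv_zero]
    have h1 := hode t
    have h2 : sphEigenvalue n 0 = 0 := by simp [sphEigenvalue]
    have h3 : iteratedDeriv 4 g t = K₂ n * iteratedDeriv 2 g t - K₀ n * g t + W t * g t := by
      linarith
    rw [h2, h3]
    module
  rw [hzero]
  simpa using hε

/-- Periodicity repeats the nonzero value at `t₀` at arbitrarily large times. -/
theorem zero_mem_indicialRoots_of_periodic (hn : 5 ≤ n) {ζ : ℝ} (hζ : ζ ∈ Set.Ioo (0 : ℝ) 1)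
    {g : ℝ → ℝ} (hg : ContDiff ℝ 5 g) {P : ℝ} (hP : 0 < P) (hper : Function.Periodic g P)
    {t₀ : ℝ} (ht₀ : g t₀ ≠ 0) {e : EuclideanSpace ℝ (Fin p)} (he : ‖e‖ = 1)
    {V : ℝ → EuclideanSpace ℝ (Fin p)} {W : ℝ → ℝ}
    (hV : ∀ t, fderiv ℝ (nonlinearity n p) (V t) e = W t • e)
    (hode : ∀ t, iteratedDeriv 4 g t - K₂ n * iteratedDeriv 2 g t + K₀ n * g t = W t * g t) :
    (0 : ℝ) ∈ indicialRoots n ζ V := by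
  refine ⟨0, _, isApproxKernel_of_periodic hζ hg hP hper hV hode, |g t₀|, abs_pos.2 ht₀, ?_⟩
  rw [frequently_atTop]
  intro N
  obtain ⟨k, hk⟩ := exists_nat_gt ((N - t₀) / P)
  rw [div_lt_iff₀ hP] at hk
  refine ⟨t₀ + k * P, by linarith, EuclideanSpace.single ⟨0, by omega⟩ 1, by simp, ?_⟩
  rw [norm_smul, he, mul_one, Real.norm_eq_abs, hper.nat_mul k t₀]

/-! ### Kernel elements from the Fowler profile -/

section Profile

variable {a : ℝ} {v : ℝ → ℝ}

/-- Bootstrapping: positivity keeps the power smooth, so the equation makes the fourth derivative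
`C²`. Six derivatives are needed for `v'` to be `C⁵`. -/
theorem IsPeriodicFowler.contDiff_six (hv : IsPeriodicFowler n a v) : ContDiff ℝ 6 v := by
  have h4 : iteratedDeriv 4 v
      = fun t => K₂ n * iteratedDeriv 2 v t - K₀ n * v t + c n * v t ^ (critExp n - 1) := by
    funext t; linarith [hv.ode t]
  have hcd : ContDiff ℝ 4 v := hv.contDiff
  have h2 : ContDiff ℝ 2 (iteratedDeriv 2 v) := by
    rw [iteratedDeriv_eq_iterate]
    exact ContDiff.iterate_deriv' 2 2 (by exact_mod_cast hcd)
  have hv2 : ContDiff ℝ 2 v := hcd.of_le (by norm_num)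
  have h : ContDiff ℝ 2 (iteratedDeriv 4 v) := by
    rw [h4]
    refine ((contDiff_const.mul h2).sub (contDiff_const.mul hv2)).add (contDiff_const.mul ?_)
    exact hv2.rpow_const_of_ne fun t => (hv.pos t).ne'
  exact_mod_cast contDiff_add_of_iteratedDeriv 2 4 (by exact_mod_cast hcd) (by exact_mod_cast h)

/-- The equation itself, read linearly with the potential of `Λ^⊥`: the infinitesimal form of
rotating `Λ`. -/
theorem IsPeriodicFowler.ode_linear (hv : IsPeriodicFowler n a v) (t : ℝ) :
    iteratedDeriv 4 v t - K₂ n * iteratedDeriv 2 v t + K₀ n * v t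
      = c n * v t ^ (critExp n - 2) * v t := by
  rw [hv.ode t, mul_assoc, ← Real.rpow_add_one (hv.pos t).ne']
  ring_nf

theorem IsPeriodicFowler.ode_deriv (hv : IsPeriodicFowler n a v) (t : ℝ) :
    iteratedDeriv 4 (deriv v) t - K₂ n * iteratedDeriv 2 (deriv v) t + K₀ n * deriv v t
      = (critExp n - 1) * (c n * v t ^ (critExp n - 2)) * deriv v t := by
  have h4 : iteratedDeriv 4 v
      = fun t => K₂ n * iteratedDeriv 2 v t - K₀ n * v t + c n * v t ^ (critExp n - 1) := by
    funext t; linarith [hv.ode t]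
  have hd : HasDerivAt v (deriv v t) t :=
    (hv.contDiff_six.differentiable (by norm_num) t).hasDerivAt
  have hd2 : HasDerivAt (iteratedDeriv 2 v) (iteratedDeriv 3 v t) t := by
    rw [iteratedDeriv_succ (n := 2)]
    exact (hv.contDiff_six.differentiable_iteratedDeriv 2 (by norm_num) t).hasDerivAt
  have h5 : iteratedDeriv 5 v t = K₂ n * iteratedDeriv 3 v t - K₀ n * deriv v t
      + c n * (deriv v t * (critExp n - 1) * v t ^ (critExp n - 1 - 1)) := by
    rw [iteratedDeriv_succ, h4]
    exact (((hd2.const_mul _).sub (hd.const_mul _)).add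
      ((hd.rpow_const (Or.inl (hv.pos t).ne')).const_mul _)).deriv
  rw [← iteratedDeriv_succ', ← iteratedDeriv_succ', h5]
  ring_nf

/-- Condition for `cos (ω t)` to solve the equation linearized at a constant profile. As a quadratic
in `ω²` it has a positive root, because `2** > 2`. -/
theorem exists_frequency (hn : 5 ≤ n) :
    ∃ ω : ℝ, 0 < ω ∧ ω ^ 4 + K₂ n * ω ^ 2 + K₀ n = (critExp n - 1) * K₀ n := by
  have h5 : (5 : ℝ) ≤ n := by exact_mod_cast hn
  have hK₀ : 0 < K₀ n := by
    have : (0 : ℝ) < n - 4 := by linarith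
    have : (0 : ℝ) < n := by linarith
    unfold K₀; positivity
  have hK₂ : 0 < K₂ n := by unfold K₂; nlinarith
  have hpos : 0 < (critExp n - 2) * K₀ n := mul_pos (critExp_sub_two_pos hn) hK₀
  set s := Real.sqrt (K₂ n ^ 2 + 4 * ((critExp n - 2) * K₀ n)) with hs
  have hs2 : s ^ 2 = K₂ n ^ 2 + 4 * ((critExp n - 2) * K₀ n) := Real.sq_sqrt (by positivity)
  have hlt : K₂ n < s := Real.lt_sqrt_of_sq_lt (by linarith)
  refine ⟨Real.sqrt ((s - K₂ n) / 2), Real.sqrt_pos.2 (by linarith), ?_⟩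
  have h2 : Real.sqrt ((s - K₂ n) / 2) ^ 2 = (s - K₂ n) / 2 := Real.sq_sqrt (by linarith)
  have h4 : Real.sqrt ((s - K₂ n) / 2) ^ 4 = ((s - K₂ n) / 2) ^ 2 := by
    rw [show (4 : ℕ) = 2 * 2 from rfl, pow_mul, h2]
  rw [h4, h2]
  linarith

/-- The translation mode `v' Λ` works unless `v` is constant. In that case `c a^(2**-2) = K₀`, the
coefficients are constant, and an oscillating solution takes its place. -/
theorem IsPeriodicFowler.zero_mem_indicialRoots (hn : 5 ≤ n) {ζ : ℝ}
    (hζ : ζ ∈ Set.Ioo (0 : ℝ) 1) (hv : IsPeriodicFowler n a v) (T : ℝ)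
    {Λ : EuclideanSpace ℝ (Fin p)} (hΛ : ‖Λ‖ = 1) :
    (0 : ℝ) ∈ indicialRoots n ζ (fowlerMap v T Λ) := by
  obtain ⟨P, hP, hper⟩ := hv.periodic
  have hV : ∀ t, fderiv ℝ (nonlinearity n p) (fowlerMap v T Λ t) Λ
      = ((critExp n - 1) * (c n * v (t + T) ^ (critExp n - 2))) • Λ := by
    intro t
    rw [fowlerMap, fderiv_nonlinearity_smul hΛ (hv.pos _), real_inner_self_eq_norm_sq, hΛ]
    module
  by_cases hconst : ∀ t, deriv v t = 0
  · have hva : ∀ t, v t = a := fun t => by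
      rw [← hv.value_zero]
      exact is_const_of_deriv_eq_zero (hv.contDiff_six.differentiable (by norm_num)) hconst t 0
    have ha : 0 < a := hva 0 ▸ hv.pos 0
    have hK : c n * a ^ (critExp n - 2) = K₀ n := by
      have h1 := hv.ode_linear 0
      have h2 : v = fun _ => a := funext hva
      rw [h2] at h1
      simp only [iteratedDeriv_const] at h1
      norm_num at h1
      exact (h1.resolve_right ha.ne').symm
    obtain ⟨ω, hω, hω4⟩ := exists_frequency hn
    refine zero_mem_indicialRoots_of_periodic hn hζ (g := fun t => Real.cos (ω * t)) (t₀ := 0)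
      (P := 2 * Real.pi / ω)
      (Real.contDiff_cos.comp (contDiff_const.mul contDiff_id)) (by positivity) ?_ (by simp)
      hΛ hV ?_
    · intro t
      have : ω * (t + 2 * Real.pi / ω) = ω * t + 2 * Real.pi := by field_simp
      simp only [this, Real.cos_add_two_pi]
    · intro t
      have h4 : iteratedDeriv 4 (fun t => Real.cos (ω * t)) t = ω ^ 4 * Real.cos (ω * t) := by
        rw [iteratedDeriv_comp_const_mul Real.contDiff_cos]
        simp [Real.iteratedDeriv_even_cos 2]
      have h2 : iteratedDeriv 2 (fun t => Real.cos (ω * t)) t = -(ω ^ 2 * Real.cos (ω * t)) := by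
        rw [iteratedDeriv_comp_const_mul Real.contDiff_cos]
        simp [Real.iteratedDeriv_even_cos 1]
      rw [h4, h2, hva, hK, ← hω4]
      ring
  · push Not at hconst
    obtain ⟨t₁, ht₁⟩ := hconst
    have hsix : ContDiff ℝ ((5 : WithTop ℕ∞) + 1) v := by
      have := hv.contDiff_six; norm_num; exact this
    have hcd : ContDiff ℝ 5 (deriv v) := (contDiff_succ_iff_deriv.1 hsix).2.2
    have hperd : Function.Periodic (deriv v) P := by
      simpa using periodic_iteratedDeriv hper 1
    refine zero_mem_indicialRoots_of_periodic hn hζ (g := fun t => deriv v (t + T))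
      (t₀ := t₁ - T) (hcd.comp (contDiff_id.add contDiff_const)) hP (fun t => ?_)
      (by simpa using ht₁) hΛ hV ?_
    · simp only [add_right_comm t P T, hperd (t + T)]
    · intro t
      rw [iteratedDeriv_comp_add_const, iteratedDeriv_comp_add_const]
      exact hv.ode_deriv (t + T)

theorem exists_unit_orthogonal (hp : 2 ≤ p) (Λ : EuclideanSpace ℝ (Fin p)) :
    ∃ e : EuclideanSpace ℝ (Fin p), ‖e‖ = 1 ∧ inner ℝ Λ e = (0 : ℝ) := by
  have hne : (Submodule.span ℝ {Λ})ᗮ ≠ ⊥ := by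
    intro h
    rw [Submodule.orthogonal_eq_bot_iff] at h
    have h1 := finrank_span_finset_le_card (R := ℝ) ({Λ} : Finset (EuclideanSpace ℝ (Fin p)))
    rw [Finset.coe_singleton, Finset.card_singleton, Set.finrank] at h1
    rw [h, finrank_top, finrank_euclideanSpace_fin] at h1
    omega
  obtain ⟨x, hx, hx0⟩ := Submodule.exists_mem_ne_zero_of_ne_bot hne
  refine ⟨‖x‖⁻¹ • x, ?_, ?_⟩
  · rw [norm_smul, norm_inv, norm_norm, inv_mul_cancel₀ (norm_ne_zero_iff.2 hx0)]
  · rw [inner_smul_right, Submodule.mem_orthogonal_singleton_iff_inner_right.1 hx, mul_zero]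

theorem IsPeriodicFowler.zero_mem_strictIndicialRoots (hn : 5 ≤ n) {ζ : ℝ}
    (hζ : ζ ∈ Set.Ioo (0 : ℝ) 1) (hv : IsPeriodicFowler n a v) (ha : 0 < a) (T : ℝ)
    {Λ : EuclideanSpace ℝ (Fin p)} (hΛ : ‖Λ‖ = 1) (hp : 2 ≤ p) :
    (0 : ℝ) ∈ strictIndicialRoots n ζ (fowlerMap v T Λ) := by
  obtain ⟨P, hP, hper⟩ := hv.periodic
  obtain ⟨e, he, hΛe⟩ := exists_unit_orthogonal hp Λ
  have hV : ∀ t, fderiv ℝ (nonlinearity n p) (fowlerMap v T Λ t) e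
      = (c n * v (t + T) ^ (critExp n - 2)) • e := by
    intro t
    rw [fowlerMap, fderiv_nonlinearity_smul hΛ (hv.pos _), hΛe]
    module
  have hcd : ContDiff ℝ 5 v := hv.contDiff_six.of_le (by norm_num)
  refine ⟨0, _, isApproxKernel_of_periodic hζ (g := fun t => v (t + T))
    (hcd.comp (contDiff_id.add contDiff_const)) hP (fun t => ?_) hV (fun t => ?_), a, ha, ?_⟩
  · simp only [add_right_comm t P T, hper (t + T)]
  · rw [iteratedDeriv_comp_add_const, iteratedDeriv_comp_add_const]
    exact hv.ode_linear (t + T)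
  · refine Eventually.of_forall fun t => ⟨EuclideanSpace.single ⟨0, by omega⟩ 1, by simp, ?_⟩
    rw [norm_smul, he, mul_one, Real.norm_eq_abs, abs_of_pos (hv.pos _)]
    exact hv.min_le _

end Profile

end EmdenFowler

/-! ### The main theorem -/

theorem mainTheorem9 (n p : ℕ) (hn : 5 ≤ n) (ζ : ℝ) (hζ : ζ ∈ Set.Ioo (0 : ℝ) 1)
    (a : ℝ) (ha : a ∈ Set.Icc 0 (EmdenFowler.a₀ n))
    (v : ℝ → ℝ) (hv : EmdenFowler.IsFowlerProfile n a v) (T : ℝ)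
    (Λ : EuclideanSpace ℝ (Fin p)) (hΛ : ‖Λ‖ = 1) (hΛ_nonneg : ∀ i, 0 ≤ Λ i) :
    (0 < a →
      (0 : ℝ) ∈ EmdenFowler.indicialRoots n ζ (EmdenFowler.fowlerMap v T Λ)) ∧
    (∃ ε : ℝ, 0 < ε ∧
      ∀ β ∈ EmdenFowler.indicialRoots n ζ (EmdenFowler.fowlerMap v T Λ), |β| < ε → β = 0) ∧
    (0 < a → 2 ≤ p →
      (0 : ℝ) ∈ EmdenFowler.strictIndicialRoots n ζ (EmdenFowler.fowlerMap v T Λ)) := by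
  rcases hv with ⟨ha0, hper⟩ | ⟨ha0, hcosh⟩
  · obtain ⟨P, hP, hvP⟩ := hper.periodic
    exact ⟨fun _ => hper.zero_mem_indicialRoots hn hζ T hΛ,
      EmdenFowler.exists_isolating_of_periodic hn ζ hper.contDiff.continuous hper.pos hP hvP T hΛ,
      fun _ hp => hper.zero_mem_strictIndicialRoots hn hζ ha0 T hΛ hp⟩
  · exact ⟨fun h => absurd ha0 h.ne', EmdenFowler.exists_isolating_of_cosh hn ζ hcosh T hΛ,
      fun h => absurd ha0 h.ne'⟩
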